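/- Let $b\in\mathbb R$ and $\tau,\sigma,\bar\sigma>0$, and let $$X(t)=\sum_{k=0}^{\lfloor t/\tau\rfloor}\frac{b^k}{k!}(t-k\tau)^k\quad(t\ge 0),\qquad X(t)=0\quad(t<0).$$ Put, for $t\ge0$, $$\upsilon(t)=\sigma^2\int_0^tX^2(q)\,dq,\qquad \sigma^2(t)=\bar\sigma^2\int_t^{t+\tau}X^2(q)\,dq,\qquad \bar\sigma_t^2=\frac{\bar\sigma^2}{\sigma^2}\,\upsilon(t+\tau)+\Bigl(1-\frac{\bar\sigma^2}{\sigma^2}\Bigr)\upsilon(t).$$ (1) $X$ is the fundamental solution of $x'(t)=bx(t-\tau)$, that is, it is continuous on $[0,\infty)$, vanishes for $t<0$, and $X(t)=1+b\int_0^tX(s-\tau)\,ds$ for $t\ge 0$. (2) Let $w$ and $W$ be standard Wiener processes on a probability space, let $\xi(s)=\bar\sigma W(s+\tau)$ for $s\in[-\tau,0]$, and assume that $\xi$ is independent of $w$. Let $x$ be a continuous pathwise solution of $$dx(t)=bx(t-\tau)\,dt+\sigma\,dw(t),\quad t\ge0,\qquad x(t)=\xi(t),\quad t\in[-\tau,0],$$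 and let $z$ be the solution of the equation without noise, $z'(t)=bz(t-\tau)$, with the same initial process $\xi$ (so $z(t)=S_t\xi(0)$, where $S_t$ is the solution map). Then for every $t\ge0$ the random variables $z(t)$ and $x(t)-z(t)$ are independent, $z(t)$ is Gaussian with mean $0$ and variance $\sigma^2(t)$, $x(t)-z(t)$ is Gaussian with mean $0$ and variance $\upsilon(t)$, and $x(t)$ is Gaussian with mean $0$ and variance $\bar\sigma_t^2=\sigma^2(t)+\upsilon(t)>0$. In particular $x(t)$ has the density $f(u,t)=(2\pi\bar\sigma_t^2)^{-1/2}e^{-u^2/(2\bar\sigma_t^2)}$. (3) For densities $f,g$ on $\mathbb R$ let $H_G(f)=-\int f\ln f\,du$ and $H_c(f|g)=-\int f\ln\frac fg\,du$. Then, for $t\ge 0$, the integral defining $H_G(f(\cdot,t))$ converges absolutely and $$H_G(f(\cdot,t))=\tfrac12+\tfrac12\ln(2\pi\bar\sigma_t^2).$$ If $\int_0^\infty X^2(q)\,dq<\infty$, put $\sigma_*^2=\sigma^2\int_0^\infty X^2(q)\,dq$ and $f_*(u)=(2\pi\sigma_*^2)^{-1/2}e^{-u^2/(2\sigma_*^2)}$.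 Then $\sigma_*^2>0$, $f(u,t)\to f_*(u)$ as $t\to\infty$ for every $u\in\mathbb R$, and, for $t\ge 0$, the integral defining $H_c(f(\cdot,t)|f_*)$ converges absolutely and $$H_c(f(\cdot,t)|f_*)=\tfrac12\ln\frac{\bar\sigma_t^2}{\sigma_*^2}+\tfrac12\Bigl(1-\frac{\bar\sigma_t^2}{\sigma_*^2}\Bigr).$$ (4) The variance and the entropies need not be monotone in time: for $b=-1$, $\tau=\bar\sigma=1$ and $\sigma=\tfrac14$ one has $\int_0^\infty X^2(q)\,dq<\infty$, and none of the three functions $t\mapsto\bar\sigma_t^2$, $t\mapsto H_G(f(\cdot,t))$, $t\mapsto H_c(f(\cdot,t)|f_*)$ is nondecreasing on $[0,\infty)$, and none of them is nonincreasing on $[0,\infty)$. -/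

import Mathlib

open MeasureTheory ProbabilityTheory Set Filter Topology
open scoped NNReal ENNReal

noncomputable section

/-- The fundamental solution `X` of `x'(t) = b x(t - τ)`, by its explicit formula:
`X(t) = ∑_{k ≤ t/τ} b^k (t - kτ)^k / k!` for `t ≥ 0`, and `X(t) = 0` for `t < 0`. -/
def fundamentalSolution (b τ t : ℝ) : ℝ :=
  if 0 ≤ t then
    ∑ k ∈ Finset.range (⌊t / τ⌋₊ + 1), b ^ k / (k.factorial : ℝ) * (t - k * τ) ^ k
  else 0

/-- `X` is a fundamental solution of `x'(t) = b x(t - τ)`: it vanishes for `t < 0`, equals `1` at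
`t = 0`, is continuous on `[0, ∞)` and solves the equation for `t ≥ 0`, in integrated form
(at `t = τ` the derivative jumps). -/
structure IsFundamentalSolution (b τ : ℝ) (X : ℝ → ℝ) : Prop where
  eq_zero : ∀ t < 0, X t = 0
  eq_one : X 0 = 1
  continuousOn : ContinuousOn X (Ici 0)
  integral_eq : ∀ t, 0 ≤ t → X t = 1 + ∫ s in (0 : ℝ)..t, b * X (s - τ)

/-- The process `x` solves `dx(t) = b x(t - τ) dt + σ dw(t)` for `t ≥ 0` with `x = ξ` on `[-τ, 0]`:
almost every path is continuous on `[-τ, ∞)`, agrees with that of `ξ` on `[-τ, 0]`, and satisfies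
the integrated equation for all `t ≥ 0`. Only the times `t ≥ -τ` of `x` matter. For `σ = 0` this is
the delay differential equation without noise, so that `x(t) = S_t ξ(0)`. -/
def IsDelaySolution {Ω : Type*} [MeasurableSpace Ω] (P : Measure Ω) (b τ σ : ℝ)
    (ξ : ℝ → Ω → ℝ) (w : ℝ≥0 → Ω → ℝ) (x : ℝ → Ω → ℝ) : Prop :=
  ∀ᵐ ω ∂P,
    ContinuousOn (fun t => x t ω) (Ici (-τ)) ∧
    (∀ t ∈ Icc (-τ) 0, x t ω = ξ t ω) ∧
    ∀ t, 0 ≤ t →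
      x t ω = ξ 0 ω + (∫ s in (0 : ℝ)..t, b * x (s - τ) ω) + σ * w t.toNNReal ω

/-- The initial process `ξ(s) = σbar W(s + τ)`, used for `s ∈ [-τ, 0]`. -/
def brownianInitial {Ω : Type*} (τ σbar : ℝ) (W : ℝ≥0 → Ω → ℝ) (s : ℝ) (ω : Ω) : ℝ :=
  σbar * W (s + τ).toNNReal ω

/-- `υ(t) = σ² ∫_0^t X(q)² dq`. -/
def noiseVariance (b τ σ t : ℝ) : ℝ :=
  σ ^ 2 * ∫ q in (0 : ℝ)..t, fundamentalSolution b τ q ^ 2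

/-- `σ²(t) = σbar² ∫_t^{t+τ} X(q)² dq`. -/
def deterministicVariance (b τ σbar t : ℝ) : ℝ :=
  σbar ^ 2 * ∫ q in t..(t + τ), fundamentalSolution b τ q ^ 2

/-- `σbar_t² = (σbar²/σ²) υ(t + τ) + (1 - σbar²/σ²) υ(t)`. -/
def totalVariance (b τ σ σbar t : ℝ) : ℝ :=
  σbar ^ 2 / σ ^ 2 * noiseVariance b τ σ (t + τ)
    + (1 - σbar ^ 2 / σ ^ 2) * noiseVariance b τ σ t

/-- `σ_*² = σ² ∫_0^∞ X(q)² dq`. -/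
def stationaryVariance (b τ σ : ℝ) : ℝ :=
  σ ^ 2 * ∫ q in Ioi (0 : ℝ), fundamentalSolution b τ q ^ 2

/-- The centred Gaussian density `f(·, t)` with variance `σbar_t²`. -/
def solutionDensity (b τ σ σbar t : ℝ) : ℝ → ℝ :=
  gaussianPDFReal 0 (totalVariance b τ σ σbar t).toNNReal

/-- The centred Gaussian density `f_*` with variance `σ_*²`. -/
def stationaryDensity (b τ σ : ℝ) : ℝ → ℝ :=
  gaussianPDFReal 0 (stationaryVariance b τ σ).toNNReal

/-- The Gibbs entropy `H_G(f) = -∫ f ln f`. -/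
def gibbsEntropy (f : ℝ → ℝ) : ℝ :=
  -∫ u, f u * Real.log (f u)

/-- The conditional entropy `H_c(f | g) = -∫ f ln (f / g)`. -/
def conditionalEntropy (f g : ℝ → ℝ) : ℝ :=
  -∫ u, f u * Real.log (f u / g u)

end

/-! ### The fundamental solution -/

/-! The noise is additive, so everything can be done path by path. Integrating `b` times the delayed
`k`-th term of `X` gives the term of index `k + 1`; hence `X` solves the integrated equation.
Differentiating `X(t - s) h(s)`, with `h` the solution minus its noise, yields
`delay_variation_of_constants`: `x(t)` splits into a linear functional of `ξ`, which is `z(t)`, and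
a linear functional of `w`.

Both functionals have the form `c B(T) + ∫ g B`, a Wiener integral after integration by parts. By
`IsBrownianReal.hasLaw_pathFunctional` it is centred Gaussian, with variance the integral of `(c +
∫ₛᵀ g)²`. The equation for `X` collapses this weight to `σbar X(t + τ - s)` for `z` and to `σ X(t -
s)` for `x - z`, which gives the two variances. Independence passes from the paths to measurable
functionals of them, and independent Gaussians add. The entropies only need second moments, since a
Gaussian log density is affine in `u²`.

In the example, `fundamentalSolution_add` makes `X` decay geometrically, so `σ_*² ≤ 9/11`. The total
variance is `1` at time `0`, exceeds `1` at `1/32`, and lies between `9/11` and `1` at `1/4`. The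
Gibbs entropy increases with the variance, and the conditional entropy decreases with it above
`σ_*²`, so the peak of the variance is a peak of the former and a valley of the latter. -/

/-- The `k`-th term of the fundamental solution, extended by zero to `s < kτ`. -/
noncomputable def delayTerm (b τ : ℝ) (k : ℕ) (s : ℝ) : ℝ :=
  (Ici (k * τ)).indicator (fun s => b ^ k / (k.factorial : ℝ) * (s - k * τ) ^ k) s

/-- Terms with `kτ > t` vanish, so the number of terms may be fixed on a whole interval; sum and
integral can then be exchanged. -/
theorem fundamentalSolution_eq_sum_delayTerm {b τ : ℝ} (hτ : 0 < τ) (N : ℕ) {t : ℝ}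
    (ht : t < N * τ) :
    fundamentalSolution b τ t = ∑ k ∈ Finset.range N, delayTerm b τ k t := by
  unfold fundamentalSolution
  split_ifs with h
  · have hlt : ⌊t / τ⌋₊ < N := by
      rw [Nat.floor_lt (by positivity), div_lt_iff₀ hτ]
      exact ht
    rw [← Finset.sum_subset (Finset.range_subset_range.2 hlt)]
    · refine Finset.sum_congr rfl fun k hk => ?_
      rw [Finset.mem_range, Nat.lt_succ_iff, Nat.le_floor_iff (by positivity),
        le_div_iff₀ hτ] at hk
      rw [delayTerm, indicator_of_mem (mem_Ici.2 hk)]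
    · intro k _ hk
      rw [Finset.mem_range, Nat.lt_succ_iff, Nat.le_floor_iff (by positivity),
        le_div_iff₀ hτ] at hk
      rw [delayTerm, indicator_of_notMem (by simpa using hk)]
  · refine (Finset.sum_eq_zero fun k _ => ?_).symm
    rw [delayTerm, indicator_of_notMem]
    rw [mem_Ici, not_le]
    exact (not_le.1 h).trans_le (by positivity)

theorem intervalIntegrable_delayTerm (b τ : ℝ) (k : ℕ) (u v : ℝ) :
    IntervalIntegrable (delayTerm b τ k) volume u v := by
  have h : IntervalIntegrable (fun s : ℝ => b ^ k / (k.factorial : ℝ) * (s - k * τ) ^ k)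
      volume u v := Continuous.intervalIntegrable (by fun_prop) _ _
  exact ⟨h.1.indicator measurableSet_Ici, h.2.indicator measurableSet_Ici⟩

theorem intervalIntegrable_fundamentalSolution {b τ : ℝ} (hτ : 0 < τ) (u v : ℝ) :
    IntervalIntegrable (fundamentalSolution b τ) volume u v := by
  obtain ⟨N, hN⟩ := exists_nat_gt (max u v / τ)
  rw [div_lt_iff₀ hτ] at hN
  have h : IntervalIntegrable (fun s => ∑ k ∈ Finset.range N, delayTerm b τ k s) volume u v :=
    by
      simpa only [← Finset.sum_apply] using IntervalIntegrable.sum (Finset.range N)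
        fun k _ => intervalIntegrable_delayTerm b τ k u v
  refine h.congr fun s hs => ?_
  exact (fundamentalSolution_eq_sum_delayTerm hτ N (lt_of_le_of_lt hs.2 hN)).symm

/-- The power rule, one step of the method of steps; before time `(k + 1)τ` both sides vanish. -/
theorem integral_delayTerm {b τ : ℝ} (hτ : 0 < τ) (k : ℕ) {t : ℝ} (ht : 0 ≤ t) :
    ∫ s in (0 : ℝ)..t, b * delayTerm b τ k (s - τ) = delayTerm b τ (k + 1) t := by
  have hk : ((k + 1 : ℕ) : ℝ) * τ = k * τ + τ := by push_cast; ring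
  have h0 : (0 : ℝ) ≤ k * τ + τ := by positivity
  have hz : ∀ s < k * τ + τ, b * delayTerm b τ k (s - τ) = 0 := by
    intro s hs
    rw [delayTerm, indicator_of_notMem (by rw [mem_Ici]; linarith), mul_zero]
  rcases lt_or_ge t (k * τ + τ) with h | h
  · rw [delayTerm, indicator_of_notMem (by rw [mem_Ici, hk]; linarith),
      intervalIntegral.integral_congr (g := fun _ => (0 : ℝ)), intervalIntegral.integral_zero]
    intro s hs
    rw [uIcc_of_le ht] at hs
    exact hz s (hs.2.trans_lt h)
  · have hi : ∀ u v, IntervalIntegrable (fun s => b * delayTerm b τ k (s - τ)) volume u v :=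
      fun u v => by
        simpa using ((intervalIntegrable_delayTerm b τ k (u - τ) (v - τ)).comp_sub_right τ).const_mul b
    rw [← intervalIntegral.integral_add_adjacent_intervals (hi 0 (k * τ + τ)) (hi _ t)]
    -- The right end point is dropped because for `k = 0` the integrand need not vanish there.
    have e1 : ∫ s in (0 : ℝ)..(k * τ + τ), b * delayTerm b τ k (s - τ) = 0 := by
      rw [intervalIntegral.integral_of_le h0, integral_Ioc_eq_integral_Ioo,
        setIntegral_congr_fun measurableSet_Ioo (fun s hs => hz s hs.2), integral_zero]
    have e2 : ∫ s in (k * τ + τ)..t, b * delayTerm b τ k (s - τ)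
        = ∫ s in (k * τ + τ)..t, b ^ (k + 1) / (k.factorial : ℝ) * (s - (k * τ + τ)) ^ k := by
      refine intervalIntegral.integral_congr fun s hs => ?_
      rw [uIcc_of_le h] at hs
      rw [delayTerm, indicator_of_mem (by rw [mem_Ici]; linarith [hs.1]), pow_succ]
      ring
    rw [e1, e2, zero_add, intervalIntegral.integral_const_mul,
      intervalIntegral.integral_comp_sub_right (fun s => s ^ k), integral_pow, delayTerm,
      indicator_of_mem (by rw [mem_Ici, hk]; exact h), hk, Nat.factorial_succ]
    push_cast
    have : (k.factorial : ℝ) ≠ 0 := by positivity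
    have : (k + 1 : ℝ) ≠ 0 := by positivity
    field_simp
    simp

theorem fundamentalSolution_of_neg {b τ t : ℝ} (ht : t < 0) : fundamentalSolution b τ t = 0 :=
  if_neg (not_le.2 ht)

theorem intervalIntegrable_fundamentalSolution_sub {b τ : ℝ} (hτ : 0 < τ) (u v : ℝ) :
    IntervalIntegrable (fun s => b * fundamentalSolution b τ (s - τ)) volume u v := by
  simpa using ((intervalIntegrable_fundamentalSolution (b := b) hτ
    (u - τ) (v - τ)).comp_sub_right τ).const_mul b

theorem fundamentalSolution_eq_one_add_integral {b τ : ℝ} (hτ : 0 < τ) {t : ℝ} (ht : 0 ≤ t) :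
    fundamentalSolution b τ t = 1 + ∫ s in (0 : ℝ)..t, b * fundamentalSolution b τ (s - τ) := by
  obtain ⟨N, hN⟩ := exists_nat_gt (t / τ)
  rw [div_lt_iff₀ hτ] at hN
  -- Integration raises each index by one, so `N` terms under the integral match `N + 1` terms
  -- outside; the zeroth gives the constant `1`.
  have hN' : t < (N + 1 : ℕ) * τ := by push_cast; linarith
  have e : ∫ s in (0 : ℝ)..t, b * fundamentalSolution b τ (s - τ)
      = ∫ s in (0 : ℝ)..t, ∑ k ∈ Finset.range N, b * delayTerm b τ k (s - τ) := by
    refine intervalIntegral.integral_congr fun s hs => ?_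
    rw [uIcc_of_le ht] at hs
    rw [fundamentalSolution_eq_sum_delayTerm hτ N (by linarith [hs.2]), Finset.mul_sum]
  rw [e, intervalIntegral.integral_finsetSum, Finset.sum_congr rfl
    (fun k _ => integral_delayTerm hτ k ht), fundamentalSolution_eq_sum_delayTerm hτ _ hN',
    Finset.sum_range_succ', add_comm]
  · congr 1
    rw [delayTerm, indicator_of_mem (by simpa using ht)]
    simp
  · intro k _
    simpa using ((intervalIntegrable_delayTerm b τ k (0 - τ) (t - τ)).comp_sub_right τ).const_mul b

theorem continuousOn_fundamentalSolution {b τ : ℝ} (hτ : 0 < τ) :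
    ContinuousOn (fundamentalSolution b τ) (Ici 0) := by
  have h : Continuous fun t => 1 + ∫ s in (0 : ℝ)..t, b * fundamentalSolution b τ (s - τ) :=
    continuous_const.add (intervalIntegral.continuous_primitive
      (fun u v => intervalIntegrable_fundamentalSolution_sub hτ u v) 0)
  exact h.continuousOn.congr fun t ht => fundamentalSolution_eq_one_add_integral hτ ht

theorem fundamentalSolution_of_mem_Icc {b τ t : ℝ} (hτ : 0 < τ) (ht : t ∈ Icc 0 τ) :
    fundamentalSolution b τ t = 1 := by
  have e : ∫ s in (0 : ℝ)..t, b * fundamentalSolution b τ (s - τ) = 0 := by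
    rw [intervalIntegral.integral_of_le ht.1, integral_Ioc_eq_integral_Ioo,
      setIntegral_congr_fun measurableSet_Ioo (g := fun _ => (0 : ℝ)), integral_zero]
    intro s hs
    simp only []
    rw [fundamentalSolution_of_neg (by linarith [hs.2, ht.2]), mul_zero]
  rw [fundamentalSolution_eq_one_add_integral hτ ht.1, e, add_zero]

theorem fundamentalSolution_zero {b τ : ℝ} (hτ : 0 < τ) : fundamentalSolution b τ 0 = 1 :=
  fundamentalSolution_of_mem_Icc hτ ⟨le_rfl, hτ.le⟩

theorem isFundamentalSolution_fundamentalSolution {b τ : ℝ} (hτ : 0 < τ) :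
    IsFundamentalSolution b τ (fundamentalSolution b τ) where
  eq_zero _ ht := fundamentalSolution_of_neg ht
  eq_one := fundamentalSolution_zero hτ
  continuousOn := continuousOn_fundamentalSolution hτ
  integral_eq _ ht := fundamentalSolution_eq_one_add_integral hτ ht

theorem continuousAt_fundamentalSolution {b τ t : ℝ} (hτ : 0 < τ) (ht : t ≠ 0) :
    ContinuousAt (fundamentalSolution b τ) t := by
  rcases lt_or_gt_of_ne ht with h | h
  · refine (continuousAt_const (y := (0 : ℝ))).congr ?_
    filter_upwards [Iio_mem_nhds h] with s hs
    exact (fundamentalSolution_of_neg hs).symm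
  · exact (continuousOn_fundamentalSolution hτ).continuousAt (Ici_mem_nhds h)

/-- The fundamental theorem of calculus in the integral equation; `t = τ` is excluded because `X`
jumps at `0`. -/
theorem hasDerivAt_fundamentalSolution {b τ t : ℝ} (hτ : 0 < τ) (ht : 0 < t) (htτ : t ≠ τ) :
    HasDerivAt (fundamentalSolution b τ) (b * fundamentalSolution b τ (t - τ)) t := by
  have hc : ContinuousAt (fun s => b * fundamentalSolution b τ (s - τ)) t :=
    ContinuousAt.const_mul (ContinuousAt.comp (f := fun s : ℝ => s - τ)
      (continuousAt_fundamentalSolution hτ (sub_ne_zero.2 htτ)) (by fun_prop)) b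
  have hi := intervalIntegrable_fundamentalSolution_sub (b := b) hτ
  have hm : StronglyMeasurableAtFilter (fun s => b * fundamentalSolution b τ (s - τ)) (𝓝 t) :=
    ⟨Ioc (t - 1) (t + 1), Ioc_mem_nhds (by linarith) (by linarith),
      (hi (t - 1) (t + 1)).1.aestronglyMeasurable⟩
  refine ((intervalIntegral.integral_hasDerivAt_right (hi 0 t) hm hc).const_add 1).congr_of_eventuallyEq ?_
  filter_upwards [Ioi_mem_nhds ht] with s hs
  exact fundamentalSolution_eq_one_add_integral hτ (le_of_lt hs)

theorem intervalIntegrable_fundamentalSolution_sq {b τ : ℝ} (hτ : 0 < τ) {u v : ℝ} (hu : 0 ≤ u)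
    (hv : 0 ≤ v) : IntervalIntegrable (fun q => fundamentalSolution b τ q ^ 2) volume u v := by
  refine ContinuousOn.intervalIntegrable ?_
  exact ((continuousOn_fundamentalSolution hτ).mono fun s hs => (le_min hu hv).trans hs.1).pow 2

/-! ### Variation of constants -/

theorem continuousOn_fundamentalSolution_const_sub {b τ t : ℝ} (hτ : 0 < τ) :
    ContinuousOn (fun s => fundamentalSolution b τ (t - s)) (Iic t) :=
  (continuousOn_fundamentalSolution hτ).comp (by fun_prop) fun s hs => by
    simpa using hs

theorem intervalIntegrable_fundamentalSolution_const_sub {b τ : ℝ} (hτ : 0 < τ) (t u v : ℝ) :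
    IntervalIntegrable (fun s => b * fundamentalSolution b τ (t - s)) volume u v := by
  simpa using ((intervalIntegrable_fundamentalSolution (b := b) hτ
    (t - u) (t - v)).comp_sub_left t).const_mul b

/-- Variation of constants for `y(t) = y₀ + ∫₀ᵗ b y(s - τ) ds + η(t)`. -/
theorem delay_variation_of_constants {b τ y₀ : ℝ} (hτ : 0 < τ) {y η : ℝ → ℝ}
    (hy : ContinuousOn y (Ici (-τ)))
    (hη : ∀ t, 0 ≤ t → y t = y₀ + (∫ s in (0 : ℝ)..t, b * y (s - τ)) + η t) {t : ℝ} (ht : 0 ≤ t) :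
    y t = fundamentalSolution b τ t * y₀
      + (∫ r in (-τ)..0, b * fundamentalSolution b τ (t - τ - r) * y r)
      + (η t + ∫ r in (0 : ℝ)..t, b * fundamentalSolution b τ (t - τ - r) * η r) := by
  set X := fundamentalSolution b τ with hX
  -- `h = y - η` on `[0, t]` is differentiable in the interior although `y` and `η` need not be, so
  -- only `h` is differentiated.
  set h : ℝ → ℝ := fun s => y₀ + ∫ r in (0 : ℝ)..s, b * y (r - τ) with hh
  have hyτ : ContinuousOn (fun s => b * y (s - τ)) (Ici 0) :=
    (hy.comp (by fun_prop) fun s hs => by simpa using hs).const_mul b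
  have hyi : ∀ s, 0 ≤ s → IntervalIntegrable (fun s => b * y (s - τ)) volume 0 s := fun s hs =>
    ContinuousOn.intervalIntegrable (hyτ.mono fun r hr => by
      rw [uIcc_of_le hs] at hr; exact hr.1)
  have hhd : ∀ s, 0 < s → HasDerivAt h (b * y (s - τ)) s := fun s hs =>
    (intervalIntegral.integral_hasDerivAt_right (hyi s hs.le)
      ((hyτ.mono Ioi_subset_Ici_self).stronglyMeasurableAtFilter isOpen_Ioi s hs)
      (hyτ.continuousAt (Ici_mem_nhds hs))).const_add y₀
  have hhc : ContinuousOn h (Icc 0 t) := by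
    refine continuousOn_const.add ?_
    have := intervalIntegral.continuousOn_primitive_interval' (hyi t ht) left_mem_uIcc
    rwa [uIcc_of_le ht] at this
  have hXc : ContinuousOn (fun s => X (t - s)) (Icc 0 t) :=
    (continuousOn_fundamentalSolution_const_sub hτ).mono fun s hs => hs.2
  have hXi : ∀ c u v, IntervalIntegrable (fun s => b * X (c - s)) volume u v :=
    intervalIntegrable_fundamentalSolution_const_sub hτ
  have h0t : uIcc 0 t = Icc 0 t := uIcc_of_le ht
  have i1 : IntervalIntegrable (fun s => b * X (t - τ - s) * h s) volume 0 t :=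
    (hXi _ _ _).mul_continuousOn (by rwa [h0t])
  have i2 : IntervalIntegrable (fun s => X (t - s) * (b * y (s - τ))) volume 0 t :=
    (hyi t ht).continuousOn_mul (by rwa [h0t])
  -- The derivative of `X(t - s) h(s)` may fail to exist only at `s = t - τ`.
  have hFTC := integral_eq_of_hasDerivAt_off_countable (a := 0) (b := t) (fun s => X (t - s) * h s)
    (fun s => X (t - s) * (b * y (s - τ)) - b * X (t - τ - s) * h s)
    (countable_singleton (t - τ)) (by rw [h0t]; exact hXc.mul hhc) (by
      intro s hs
      rw [min_eq_left ht, max_eq_right ht] at hs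
      have hne : t - s ≠ τ := fun e => hs.2 (by simp [← e])
      have hd := (hasDerivAt_fundamentalSolution (b := b) hτ
        (sub_pos.2 hs.1.2) hne).comp_const_sub t s
      convert! hd.mul (hhd s hs.1.1) using 1
      rw [hX, show t - s - τ = t - τ - s by ring]
      ring) (i2.sub i1)
  rw [intervalIntegral.integral_sub i2 i1] at hFTC
  have hh0 : h 0 = y₀ := by simp [hh]
  have hX0 : X 0 = 1 := fundamentalSolution_zero hτ
  simp only [sub_self, sub_zero, hh0, hX0, one_mul] at hFTC
  have hk : ∀ u ∈ Icc (-τ) t, ∀ v ∈ Icc (-τ) t,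
      IntervalIntegrable (fun r => b * X (t - τ - r) * y r) volume u v := fun u hu v hv =>
    (hXi _ _ _).mul_continuousOn (hy.mono fun r hr =>
      (le_min hu.1 hv.1).trans hr.1)
  have hsub : ∫ s in (0 : ℝ)..t, X (t - s) * (b * y (s - τ))
      = ∫ r in (-τ)..(t - τ), b * X (t - τ - r) * y r := by
    have := intervalIntegral.integral_comp_sub_right (a := 0) (b := t)
      (fun r => b * X (t - τ - r) * y r) τ
    rw [zero_sub] at this
    rw [← this]
    refine intervalIntegral.integral_congr fun s _ => ?_
    rw [show t - τ - (s - τ) = t - s by ring]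
    ring
  -- `X` vanishes at negative times, so the integral over `[-τ, t - τ]` extends to `[-τ, t]` and can
  -- be cut at `0` instead.
  have hz : ∫ r in (t - τ)..t, b * X (t - τ - r) * y r = 0 := by
    rw [intervalIntegral.integral_of_le (by linarith),
      setIntegral_congr_fun measurableSet_Ioc (g := fun _ => (0 : ℝ)), integral_zero]
    intro s hs
    simp only []
    rw [hX, fundamentalSolution_of_neg (by linarith [hs.1]), mul_zero, zero_mul]
  have m1 : -τ ∈ Icc (-τ) t := ⟨le_rfl, by linarith⟩
  have m2 : t - τ ∈ Icc (-τ) t := ⟨by linarith, by linarith⟩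
  have m3 : t ∈ Icc (-τ) t := ⟨by linarith, le_rfl⟩
  have m4 : (0 : ℝ) ∈ Icc (-τ) t := ⟨by linarith, ht⟩
  have s1 := intervalIntegral.integral_add_adjacent_intervals (hk _ m1 _ m2) (hk _ m2 _ m3)
  have s2 := intervalIntegral.integral_add_adjacent_intervals (hk _ m1 _ m4) (hk _ m4 _ m3)
  have hη' : ∫ r in (0 : ℝ)..t, b * X (t - τ - r) * η r
      = (∫ r in (0 : ℝ)..t, b * X (t - τ - r) * y r)
        - ∫ r in (0 : ℝ)..t, b * X (t - τ - r) * h r := by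
    rw [← intervalIntegral.integral_sub (hk _ m4 _ m3) i1]
    refine intervalIntegral.integral_congr fun s hs => ?_
    rw [h0t] at hs
    simp only [hη s hs.1, hh]
    ring
  have hyt : y t = h t + η t := hη t ht
  rw [hη', hyt]
  linarith

/-! ### Linear functionals of Brownian motion -/

/-- The nodes of the uniform partition of `[0, T]` into `n + 1` intervals. -/
noncomputable def uniformNode (T : ℝ) (n k : ℕ) : ℝ := k * (T / (n + 1))

theorem uniformNode_zero (T : ℝ) (n : ℕ) : uniformNode T n 0 = 0 := by simp [uniformNode]

theorem uniformNode_last (T : ℝ) (n : ℕ) : uniformNode T n (n + 1) = T := by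
  have : (n + 1 : ℝ) ≠ 0 := by positivity
  simp only [uniformNode, Nat.cast_add, Nat.cast_one]
  field_simp

theorem monotone_uniformNode {T : ℝ} (hT : 0 ≤ T) (n : ℕ) : Monotone (uniformNode T n) :=
  fun _ _ h => mul_le_mul_of_nonneg_right (Nat.cast_le.2 h) (by positivity)

theorem uniformNode_succ_sub (T : ℝ) (n k : ℕ) :
    uniformNode T n (k + 1) - uniformNode T n k = T / (n + 1) := by
  simp only [uniformNode, Nat.cast_add, Nat.cast_one]
  ring

theorem uniformNode_mem_Icc {T : ℝ} (hT : 0 ≤ T) {n k : ℕ} (hk : k ≤ n + 1) :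
    uniformNode T n k ∈ Icc 0 T :=
  ⟨by unfold uniformNode; positivity,
    (monotone_uniformNode hT n hk).trans_eq (uniformNode_last T n)⟩

/-- Riemann-type sums, weighted by an integrable function; `j = 0` and `j = 1` give the left and the
right end points as tags. -/
theorem tendsto_sum_mul_integral {T : ℝ} (hT : 0 ≤ T) {f g : ℝ → ℝ} (hf : ContinuousOn f (Icc 0 T))
    (hg : IntervalIntegrable g volume 0 T) {j : ℕ} (hj : j ≤ 1) :
    Tendsto (fun n : ℕ => ∑ k ∈ Finset.range (n + 1), f (uniformNode T n (k + j))
      * ∫ s in uniformNode T n k..uniformNode T n (k + 1), g s) atTop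
      (𝓝 (∫ s in (0 : ℝ)..T, f s * g s)) := by
  have hsub : ∀ n k, k < n + 1 →
      uIcc (uniformNode T n k) (uniformNode T n (k + 1)) ⊆ uIcc 0 T := by
    intro n k hk
    rw [uIcc_of_le (monotone_uniformNode hT n k.le_succ), uIcc_of_le hT]
    exact Icc_subset_Icc (uniformNode_mem_Icc hT hk.le).1 (uniformNode_mem_Icc hT hk).2
  have hgi : ∀ n k, k < n + 1 →
      IntervalIntegrable g volume (uniformNode T n k) (uniformNode T n (k + 1)) :=
    fun n k hk => hg.mono_set (hsub n k hk)
  have hfg : IntervalIntegrable (fun s => f s * g s) volume 0 T :=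
    hg.continuousOn_mul (by rwa [uIcc_of_le hT])
  have hfgi : ∀ n k, k < n + 1 →
      IntervalIntegrable (fun s => f s * g s) volume (uniformNode T n k) (uniformNode T n (k + 1)) :=
    fun n k hk => hfg.mono_set (hsub n k hk)
  rw [Metric.tendsto_atTop]
  intro ε hε
  set K := ∫ s in (0 : ℝ)..T, |g s| with hK
  have hK0 : 0 ≤ K := intervalIntegral.integral_nonneg hT fun _ _ => abs_nonneg _
  have hε' : 0 < ε / (K + 1) := by positivity
  obtain ⟨δ, hδ, h⟩ := Metric.uniformContinuousOn_iff_le.1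
    (isCompact_Icc.uniformContinuousOn_of_continuous hf) _ hε'
  obtain ⟨N, hN⟩ := exists_nat_gt (T / δ)
  refine ⟨N, fun n hn => ?_⟩
  have hmesh : T / (n + 1) ≤ δ := by
    rw [div_lt_iff₀ hδ] at hN
    rw [div_le_iff₀ (by positivity)]
    have : (N : ℝ) ≤ n := Nat.cast_le.2 hn
    nlinarith
  have hsplit := intervalIntegral.sum_integral_adjacent_intervals (hfgi n)
  rw [uniformNode_zero, uniformNode_last] at hsplit
  -- The error is shared among the subintervals in proportion to the integral of `|g|`; `K + 1`
  -- avoids division by zero.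
  have hsplit' := intervalIntegral.sum_integral_adjacent_intervals
    (f := fun s => ε / (K + 1) * |g s|) (μ := volume) (a := uniformNode T n) (n := n + 1)
    (fun k hk => (hgi n k hk).abs.const_mul _)
  rw [uniformNode_zero, uniformNode_last, intervalIntegral.integral_const_mul, ← hK] at hsplit'
  have hle : dist (∑ k ∈ Finset.range (n + 1), f (uniformNode T n (k + j))
      * ∫ s in uniformNode T n k..uniformNode T n (k + 1), g s) (∫ s in (0 : ℝ)..T, f s * g s)
      ≤ ε / (K + 1) * K := by
    rw [← hsplit, ← hsplit', Real.dist_eq, ← Finset.sum_sub_distrib]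
    refine (Finset.abs_sum_le_sum_abs _ _).trans (Finset.sum_le_sum fun k hk => ?_)
    rw [Finset.mem_range] at hk
    rw [← intervalIntegral.integral_const_mul, ← intervalIntegral.integral_sub
      ((hgi n k hk).const_mul _) (hfgi n k hk), ← Real.norm_eq_abs]
    refine intervalIntegral.norm_integral_le_of_norm_le (monotone_uniformNode hT n k.le_succ)
      (ae_of_all _ fun s hs => ?_) ((hgi n k hk).abs.const_mul _)
    rw [← sub_mul, norm_mul, Real.norm_eq_abs (g s), ← dist_eq_norm]
    refine mul_le_mul_of_nonneg_right (h _ (uniformNode_mem_Icc hT (by omega)) _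
      ⟨(uniformNode_mem_Icc hT hk.le).1.trans hs.1.le,
        hs.2.trans (uniformNode_mem_Icc hT hk).2⟩ ?_) (abs_nonneg _)
    have e := uniformNode_succ_sub T n k
    have e1 := monotone_uniformNode hT n (show k ≤ k + j by omega)
    have e2 := monotone_uniformNode hT n (show k + j ≤ k + 1 by omega)
    rw [Real.dist_eq, abs_le]
    constructor <;> linarith [hs.1, hs.2]
  refine hle.trans_lt ?_
  rw [div_mul_eq_mul_div, div_lt_iff₀ (by positivity)]
  nlinarith

/-- The functional `p ↦ c p(T) + ∫₀ᵀ g(s) p(s) ds` on continuous paths extends to a functional that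
is measurable for the product σ-algebra. -/
theorem exists_measurable_pathFunctional {S : Type*} (e : ℝ → S) {T : ℝ} (c : ℝ) (hT : 0 ≤ T)
    {g : ℝ → ℝ} (hg : IntervalIntegrable g volume 0 T) :
    ∃ Φ : (S → ℝ) → ℝ, Measurable Φ ∧ ∀ p : S → ℝ, ContinuousOn (fun s => p (e s)) (Icc 0 T) →
      Φ p = c * p (e T) + ∫ s in (0 : ℝ)..T, g s * p (e s) := by
  -- The `limsup` is measurable whether or not the sums converge, and on continuous paths it is the
  -- integral.
  refine ⟨fun p => c * p (e T) + limsup (fun n : ℕ => ∑ k ∈ Finset.range (n + 1),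
    p (e (uniformNode T n (k + 0)))
      * ∫ s in uniformNode T n k..uniformNode T n (k + 1), g s) atTop, ?_, fun p hp => ?_⟩
  · refine (measurable_const.mul (measurable_pi_apply _)).add (Measurable.limsup fun n => ?_)
    exact Finset.measurable_fun_sum _ fun k _ => (measurable_pi_apply _).mul_const _
  · simp only [(tendsto_sum_mul_integral hT hp hg zero_le_one).limsup_eq, mul_comm]

section Gaussian

variable {Ω : Type*} [MeasurableSpace Ω] {P : Measure Ω}

/-- An almost sure limit of centred Gaussian variables whose variances converge is centred
Gaussian. -/
theorem hasLaw_gaussianReal_of_tendsto {S : ℕ → Ω → ℝ} {Y : Ω → ℝ} {v : ℕ → ℝ≥0} {v₀ : ℝ≥0}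
    (hS : ∀ n, HasLaw (S n) (gaussianReal 0 (v n)) P)
    (hY : ∀ᵐ ω ∂P, Tendsto (fun n => S n ω) atTop (𝓝 (Y ω))) (hv : Tendsto v atTop (𝓝 v₀)) :
    HasLaw Y (gaussianReal 0 v₀) P := by
  have : IsProbabilityMeasure P := (hS 0).isProbabilityMeasure
  have hm : AEMeasurable Y P :=
    aemeasurable_of_tendsto_metrizable_ae atTop (fun n => (hS n).aemeasurable) hY
  refine ⟨hm, ?_⟩
  have := Measure.isProbabilityMeasure_map hm
  -- Characteristic functions converge to that of `Y` by dominated convergence, and to the Gaussian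
  -- one by continuity in the variance.
  refine Measure.ext_of_charFun (funext fun u => ?_)
  have hmap : ∀ {Z : Ω → ℝ}, AEMeasurable Z P →
      charFun (P.map Z) u = ∫ ω, Complex.exp (u * Z ω * Complex.I) ∂P := fun hZ => by
    rw [charFun_apply_real, integral_map hZ (by fun_prop)]
  have h1 : Tendsto (fun n => charFun (P.map (S n)) u) atTop (𝓝 (charFun (P.map Y) u)) := by
    simp only [hmap (hS _).aemeasurable, hmap hm]
    refine tendsto_integral_of_dominated_convergence (fun _ => 1) (fun n => ?_)
      (integrable_const _) (fun n => ae_of_all _ fun ω => ?_) ?_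
    · have := (hS n).aemeasurable
      exact AEMeasurable.aestronglyMeasurable (by fun_prop)
    · rw [← Complex.ofReal_mul, Complex.norm_exp_ofReal_mul_I]
    · filter_upwards [hY] with ω hω
      have hc : Continuous fun x : ℝ => Complex.exp (u * x * Complex.I) := by fun_prop
      exact (hc.tendsto _).comp hω
  refine tendsto_nhds_unique h1 ?_
  simp only [(hS _).map_eq, charFun_gaussianReal]
  have hc : Continuous fun x : ℝ≥0 =>
      Complex.exp (u * (0 : ℝ) * Complex.I - ((x : ℝ) : ℂ) * u ^ 2 / 2) := by fun_prop
  exact (hc.tendsto _).comp hv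

/-- Increments along a monotone sequence are independent centred Gaussians, so the variances add. -/
theorem ProbabilityTheory.IsPreBrownianReal.hasLaw_sum_increments {B : ℝ≥0 → Ω → ℝ}
    (hB : IsPreBrownianReal B P) {t : ℕ → ℝ≥0} (ht : Monotone t) (c : ℕ → ℝ) (m : ℕ) :
    HasLaw (fun ω => ∑ k ∈ Finset.range m, c k * (B (t (k + 1)) ω - B (t k) ω))
      (gaussianReal 0 (∑ k ∈ Finset.range m, c k ^ 2 * ((t (k + 1) : ℝ) - t k)).toNNReal) P := by
  have : IsProbabilityMeasure P := hB.isGaussianProcess.isProbabilityMeasure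
  have hm := hB.aemeasurable
  set D : ℕ → Ω → ℝ := fun k ω => c k * (B (t (k + 1)) ω - B (t k) ω) with hD
  have hDm : ∀ k, AEMeasurable (D k) P := fun k => ((hm _).sub (hm _)).const_mul _
  have hind : iIndepFun D P :=
    (hB.hasIndepIncrements.nat ht).comp (fun k x => c k * x) (fun k => by fun_prop)
  have ht0 : ∀ k, 0 ≤ c k ^ 2 * ((t (k + 1) : ℝ) - t k) := fun k =>
    mul_nonneg (sq_nonneg _) (sub_nonneg.2 (ht k.le_succ))
  have hlaw : ∀ k, HasLaw (D k) (gaussianReal 0 (c k ^ 2 * ((t (k + 1) : ℝ) - t k)).toNNReal) P := by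
    intro k
    convert gaussianReal_const_mul (hB.hasLaw_sub (t (k + 1)) (t k)) (c k) using 1
    · rfl
    · rw [mul_zero]
      congr 1
      ext
      rw [Real.coe_toNNReal _ (ht0 k), NNReal.coe_mul, coe_nndist, Real.dist_eq]
      exact congrArg (c k ^ 2 * ·)
        (abs_of_nonneg (sub_nonneg.2 (NNReal.coe_le_coe.2 (ht k.le_succ)))).symm
  induction m with
  | zero =>
    simp only [Finset.range_zero, Finset.sum_empty, Real.toNNReal_zero, gaussianReal_zero_var]
    exact hasLaw_dirac_of_ae_eq (ae_of_all _ fun _ => rfl)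
  | succ m ih =>
    have hi : IndepFun (∑ k ∈ Finset.range m, D k) (D m) P :=
      hind.indepFun_finsetSum_of_notMem₀ hDm Finset.notMem_range_self
    have ih' : HasLaw (∑ k ∈ Finset.range m, D k)
        (gaussianReal 0 (∑ k ∈ Finset.range m, c k ^ 2 * ((t (k + 1) : ℝ) - t k)).toNNReal) P := by
      convert ih using 1
      ext ω
      simp [hD]
    have hsum : (fun ω => ∑ k ∈ Finset.range (m + 1), c k * (B (t (k + 1)) ω - B (t k) ω))
        = (∑ k ∈ Finset.range m, D k) + D m := by
      ext ω
      simp [hD, Finset.sum_range_succ]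
    rw [hsum, Finset.sum_range_succ, Real.toNNReal_add (Finset.sum_nonneg fun k _ => ht0 k) (ht0 m)]
    refine ⟨ih'.aemeasurable.add (hDm m), ?_⟩
    rw [gaussianReal_add_gaussianReal_of_indepFun hi ih'.map_eq (hlaw m).map_eq, add_zero]

/-- Abel summation: Wiener sums of `G` tagged on the right become sums of `β`, tagged on the left,
against increments of `G`. -/
theorem sum_range_succ_mul_sub (G β : ℕ → ℝ) (m : ℕ) :
    ∑ k ∈ Finset.range m, G (k + 1) * (β (k + 1) - β k)
      = G m * β m - G 0 * β 0 - ∑ k ∈ Finset.range m, β k * (G (k + 1) - G k) := by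
  induction m with
  | zero => simp
  | succ m ih => rw [Finset.sum_range_succ, Finset.sum_range_succ, ih]; ring

/-- The Wiener integral `∫₀ᵀ (c + ∫ₛᵀ g) dB(s)`, integrated by parts. -/
theorem ProbabilityTheory.IsBrownianReal.hasLaw_pathFunctional {B : ℝ≥0 → Ω → ℝ} (hB : IsBrownianReal B P) {T : ℝ}
    (hT : 0 ≤ T) (c : ℝ) {g : ℝ → ℝ} (hg : IntervalIntegrable g volume 0 T) :
    HasLaw (fun ω => c * B T.toNNReal ω + ∫ s in (0 : ℝ)..T, g s * B s.toNNReal ω)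
      (gaussianReal 0 (∫ s in (0 : ℝ)..T, (c + ∫ u in s..T, g u) ^ 2).toNNReal) P := by
  set G : ℝ → ℝ := fun s => c + ∫ u in s..T, g u with hG
  have hGc : ContinuousOn G (Icc 0 T) := by
    have := (intervalIntegral.continuousOn_primitive_interval' hg
      (right_mem_uIcc)).neg.const_add c
    rw [uIcc_of_le hT] at this
    refine this.congr fun s _ => ?_
    simp only [hG]
    rw [intervalIntegral.integral_symm, Pi.neg_apply]
  have hi : ∀ u ∈ Icc 0 T, ∀ v ∈ Icc 0 T, IntervalIntegrable g volume u v := fun u hu v hv =>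
    hg.mono_set (by rw [uIcc_of_le hT]; exact uIcc_subset_Icc hu hv)
  set t : ℕ → ℕ → ℝ≥0 := fun n k => (uniformNode T n k).toNNReal with htd
  have ht : ∀ n, Monotone (t n) := fun n k l hkl =>
    Real.toNNReal_mono (monotone_uniformNode hT n hkl)
  have hcoe : ∀ n k, ((t n k : ℝ≥0) : ℝ) = uniformNode T n k := fun n k =>
    Real.coe_toNNReal _ (by unfold uniformNode; positivity)
  -- The Wiener sums of `G` converge along almost every path after summation by parts; their
  -- variances are right-tagged Riemann sums of `G²`.
  refine hasLaw_gaussianReal_of_tendsto (fun n => hB.toIsPreBrownianReal.hasLaw_sum_increments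
    (ht n) (fun k => G (uniformNode T n (k + 1))) (n + 1)) ?_ ?_
  · filter_upwards [hB.cont, hB.eval_zero_ae_eq_zero] with ω hω h0
    have hlim := tendsto_sum_mul_integral hT (f := fun s => B s.toNNReal ω) (j := 0)
      (by fun_prop) hg zero_le_one
    simp only [mul_comm (g _)]
    refine (hlim.const_add (c * B T.toNNReal ω)).congr fun n => ?_
    rw [sum_range_succ_mul_sub (fun k => G (uniformNode T n k)) (fun k => B (t n k) ω)]
    have h0' : B (t n 0) ω = 0 := by simpa [htd, uniformNode_zero] using h0
    have hlast : t n (n + 1) = T.toNNReal := by rw [htd]; simp only [uniformNode_last]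
    rw [h0', hlast, uniformNode_last, mul_zero, sub_zero, sub_eq_add_neg, ← Finset.sum_neg_distrib]
    congr 1
    · simp [hG]
    · refine Finset.sum_congr rfl fun k hk => ?_
      rw [Finset.mem_range] at hk
      have m1 := uniformNode_mem_Icc hT hk.le
      have m2 := uniformNode_mem_Icc hT (show k + 1 ≤ n + 1 from hk)
      have := intervalIntegral.integral_add_adjacent_intervals (hi _ m1 _ m2)
        (hi _ m2 T ⟨hT, le_rfl⟩)
      simp only [hG, htd, add_zero, ← this]
      ring
  · refine (continuous_real_toNNReal.tendsto _).comp ?_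
    have hlim := tendsto_sum_mul_integral hT (f := fun s => G s ^ 2) (g := fun _ => 1) (j := 1)
      (hGc.pow 2) (by simp) le_rfl
    simp only [mul_one] at hlim
    refine hlim.congr fun n => Finset.sum_congr rfl fun k _ => ?_
    simp [hcoe]

end Gaussian

/-! ### Entropies of Gaussian densities -/

theorem log_gaussianPDFReal_zero {v : ℝ} (hv : 0 < v) (u : ℝ) :
    Real.log (gaussianPDFReal 0 v.toNNReal u)
      = -(1 / 2) * Real.log (2 * Real.pi * v) + -(1 / (2 * v)) * u ^ 2 := by
  have h : 0 < 2 * Real.pi * v := by positivity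
  rw [gaussianPDFReal, Real.coe_toNNReal v hv.le, Real.log_mul (by positivity) (by positivity),
    Real.log_exp, Real.log_inv, Real.log_sqrt h.le]
  ring

theorem integrable_gaussianPDFReal_mul_quadratic {v : ℝ} (hv : 0 < v) (α β : ℝ) :
    Integrable (fun u => gaussianPDFReal 0 v.toNNReal u * (α + β * u ^ 2)) := by
  have hv' : v.toNNReal ≠ 0 := by simpa using hv
  have h2 : Integrable (fun u : ℝ => α + β * u ^ 2) (gaussianReal 0 v.toNNReal) :=
    (integrable_const α).add ((memLp_id_gaussianReal' 2 (by simp)).integrable_sq.const_mul β)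
  rw [gaussianReal_of_var_ne_zero _ hv', integrable_withDensity_iff_integrable_smul'
    (measurable_gaussianPDF _ _) (ae_of_all _ fun _ => gaussianPDF_lt_top)] at h2
  simpa using h2

theorem integral_gaussianPDFReal_mul_quadratic {v : ℝ} (hv : 0 < v) (α β : ℝ) :
    ∫ u, gaussianPDFReal 0 v.toNNReal u * (α + β * u ^ 2) = α + β * v := by
  have hv' : v.toNNReal ≠ 0 := by simpa using hv
  have hsq : ∫ u, u ^ 2 ∂(gaussianReal 0 v.toNNReal) = v := by
    have := variance_fun_id_gaussianReal (μ := 0) (v := v.toNNReal)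
    rw [variance_eq_integral measurable_id'.aemeasurable, integral_id_gaussianReal] at this
    simpa [hv.le] using this
  have e := integral_gaussianReal_eq_integral_smul (μ := 0) hv' (f := fun u : ℝ => α + β * u ^ 2)
  simp only [smul_eq_mul] at e
  have hi : Integrable (fun u : ℝ => u ^ 2) (gaussianReal 0 v.toNNReal) :=
    (memLp_id_gaussianReal' 2 (by simp)).integrable_sq
  rw [← e, integral_add (integrable_const α) (hi.const_mul β), integral_const_mul]
  simp [hsq]

theorem integrable_gaussianPDFReal_mul_log {v : ℝ} (hv : 0 < v) :
    Integrable (fun u => gaussianPDFReal 0 v.toNNReal u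
      * Real.log (gaussianPDFReal 0 v.toNNReal u)) := by
  simp only [log_gaussianPDFReal_zero hv]
  exact integrable_gaussianPDFReal_mul_quadratic hv _ _

theorem gibbsEntropy_gaussianPDFReal {v : ℝ} (hv : 0 < v) :
    gibbsEntropy (gaussianPDFReal 0 v.toNNReal) = 1 / 2 + 1 / 2 * Real.log (2 * Real.pi * v) := by
  simp only [gibbsEntropy, log_gaussianPDFReal_zero hv]
  rw [integral_gaussianPDFReal_mul_quadratic hv]
  field_simp
  ring

theorem log_gaussianPDFReal_div {v w : ℝ} (hv : 0 < v) (hw : 0 < w) (u : ℝ) :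
    Real.log (gaussianPDFReal 0 v.toNNReal u / gaussianPDFReal 0 w.toNNReal u)
      = -(1 / 2) * Real.log (v / w) + (1 / (2 * w) - 1 / (2 * v)) * u ^ 2 := by
  have hv' : v.toNNReal ≠ 0 := by simpa using hv
  have hw' : w.toNNReal ≠ 0 := by simpa using hw
  rw [Real.log_div (gaussianPDFReal_pos _ _ _ hv').ne' (gaussianPDFReal_pos _ _ _ hw').ne',
    log_gaussianPDFReal_zero hv, log_gaussianPDFReal_zero hw,
    Real.log_mul (by positivity) hv.ne', Real.log_mul (by positivity) hw.ne',
    Real.log_div hv.ne' hw.ne']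
  ring

theorem integrable_gaussianPDFReal_mul_log_div {v w : ℝ} (hv : 0 < v) (hw : 0 < w) :
    Integrable (fun u => gaussianPDFReal 0 v.toNNReal u
      * Real.log (gaussianPDFReal 0 v.toNNReal u / gaussianPDFReal 0 w.toNNReal u)) := by
  simp only [log_gaussianPDFReal_div hv hw]
  exact integrable_gaussianPDFReal_mul_quadratic hv _ _

theorem conditionalEntropy_gaussianPDFReal {v w : ℝ} (hv : 0 < v) (hw : 0 < w) :
    conditionalEntropy (gaussianPDFReal 0 v.toNNReal) (gaussianPDFReal 0 w.toNNReal)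
      = 1 / 2 * Real.log (v / w) + 1 / 2 * (1 - v / w) := by
  simp only [conditionalEntropy, log_gaussianPDFReal_div hv hw]
  rw [integral_gaussianPDFReal_mul_quadratic hv]
  field_simp
  ring

theorem tendsto_gaussianPDFReal_zero {ι : Type*} {l : Filter ι} {v : ι → ℝ} {w : ℝ} (hw : 0 < w)
    (hv : Tendsto v l (𝓝 w)) (u : ℝ) :
    Tendsto (fun i => gaussianPDFReal 0 (v i).toNNReal u) l
      (𝓝 (gaussianPDFReal 0 w.toNNReal u)) := by
  have hc : ContinuousAt (fun x : ℝ => gaussianPDFReal 0 x.toNNReal u) w := by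
    have h0 : (0 : ℝ) < √(2 * Real.pi * w.toNNReal) := by
      rw [Real.coe_toNNReal w hw.le]
      positivity
    have h1 : (2 * (w.toNNReal : ℝ)) ≠ 0 := by
      rw [Real.coe_toNNReal w hw.le]
      positivity
    have hn : ContinuousAt (fun x : ℝ => (x.toNNReal : ℝ)) w := by fun_prop
    unfold gaussianPDFReal
    exact (((hn.const_mul (2 * Real.pi)).sqrt).inv₀ h0.ne').mul
      ((continuousAt_const.div (hn.const_mul 2) h1).rexp)
  exact hc.tendsto.comp hv

/-! ### Variances -/

theorem totalVariance_eq {b τ σ σbar t : ℝ} (hτ : 0 < τ) (hσ : 0 < σ) (ht : 0 ≤ t) :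
    totalVariance b τ σ σbar t
      = deterministicVariance b τ σbar t + noiseVariance b τ σ t := by
  have h := intervalIntegral.integral_add_adjacent_intervals
    (intervalIntegrable_fundamentalSolution_sq (b := b) hτ le_rfl ht)
    (intervalIntegrable_fundamentalSolution_sq (b := b) hτ ht (by linarith : 0 ≤ t + τ))
  unfold totalVariance deterministicVariance noiseVariance
  rw [← h]
  field_simp
  ring

theorem noiseVariance_nonneg (b τ σ : ℝ) {t : ℝ} (ht : 0 ≤ t) : 0 ≤ noiseVariance b τ σ t :=
  mul_nonneg (sq_nonneg _) (intervalIntegral.integral_nonneg ht fun _ _ => sq_nonneg _)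

theorem deterministicVariance_nonneg (b σbar t : ℝ) {τ : ℝ} (hτ : 0 < τ) :
    0 ≤ deterministicVariance b τ σbar t :=
  mul_nonneg (sq_nonneg _) (intervalIntegral.integral_nonneg (by linarith) fun _ _ => sq_nonneg _)

theorem integral_fundamentalSolution_sq_eq {b τ t : ℝ} (hτ : 0 < τ) (ht : t ∈ Icc 0 τ) :
    ∫ q in (0 : ℝ)..t, fundamentalSolution b τ q ^ 2 = t := by
  rw [intervalIntegral.integral_congr (g := fun _ => (1 : ℝ))]
  · simp
  · intro s hs
    rw [uIcc_of_le ht.1] at hs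
    simp only []
    rw [fundamentalSolution_of_mem_Icc hτ ⟨hs.1, hs.2.trans ht.2⟩, one_pow]

theorem le_integral_fundamentalSolution_sq {b τ t : ℝ} (hτ : 0 < τ) (ht : τ ≤ t) :
    τ ≤ ∫ q in (0 : ℝ)..t, fundamentalSolution b τ q ^ 2 := by
  have h0 : 0 ≤ t := hτ.le.trans ht
  have h := intervalIntegral.integral_add_adjacent_intervals
    (intervalIntegrable_fundamentalSolution_sq (b := b) hτ le_rfl hτ.le)
    (intervalIntegrable_fundamentalSolution_sq (b := b) hτ hτ.le h0)
  rw [integral_fundamentalSolution_sq_eq hτ ⟨hτ.le, le_rfl⟩] at h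
  have : 0 ≤ ∫ q in τ..t, fundamentalSolution b τ q ^ 2 :=
    intervalIntegral.integral_nonneg ht fun _ _ => sq_nonneg _
  linarith

theorem totalVariance_pos {b τ σ σbar t : ℝ} (hτ : 0 < τ) (hσ : 0 < σ) (hσbar : 0 < σbar)
    (ht : 0 ≤ t) : 0 < totalVariance b τ σ σbar t := by
  have hd := deterministicVariance_nonneg b σbar t hτ
  have hn := noiseVariance_nonneg b τ σ ht
  rw [totalVariance_eq hτ hσ ht]
  have hi : IntervalIntegrable (fun q => fundamentalSolution b τ q ^ 2) volume 0 t :=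
    intervalIntegrable_fundamentalSolution_sq hτ le_rfl ht
  have h := intervalIntegral.integral_add_adjacent_intervals hi
    (intervalIntegrable_fundamentalSolution_sq (b := b) hτ ht (by linarith : 0 ≤ t + τ))
  have hle := le_integral_fundamentalSolution_sq (b := b) hτ (by linarith : τ ≤ t + τ)
  -- Otherwise both integrals of `X²` vanish, yet together they are at least `τ`, since `X = 1` on
  -- `[0, τ]`.
  by_contra! hneg
  have h1 : noiseVariance b τ σ t = 0 := by linarith
  have h2 : deterministicVariance b τ σbar t = 0 := by linarith
  rw [noiseVariance, mul_eq_zero_iff_left (by positivity)] at h1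
  rw [deterministicVariance, mul_eq_zero_iff_left (by positivity)] at h2
  linarith

/-- The two weights sum to `1`, and both noise variances have the same limit. -/
theorem tendsto_totalVariance {b τ σ σbar : ℝ}
    (h : IntegrableOn (fun q => fundamentalSolution b τ q ^ 2) (Ioi 0)) :
    Tendsto (totalVariance b τ σ σbar) atTop (𝓝 (stationaryVariance b τ σ)) := by
  have hn : Tendsto (noiseVariance b τ σ) atTop (𝓝 (stationaryVariance b τ σ)) :=
    (intervalIntegral_tendsto_integral_Ioi 0 h tendsto_id).const_mul _
  have h1 := (hn.comp (tendsto_atTop_add_const_right atTop τ tendsto_id)).const_mul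
    (σbar ^ 2 / σ ^ 2)
  have h2 := h1.add (hn.const_mul (1 - σbar ^ 2 / σ ^ 2))
  rw [← add_mul, add_sub_cancel, one_mul] at h2
  exact h2

theorem stationaryVariance_pos {b τ σ : ℝ} (hτ : 0 < τ) (hσ : 0 < σ)
    (h : IntegrableOn (fun q => fundamentalSolution b τ q ^ 2) (Ioi 0)) :
    0 < stationaryVariance b τ σ := by
  refine mul_pos (by positivity) (hτ.trans_le ?_)
  refine ge_of_tendsto (intervalIntegral_tendsto_integral_Ioi 0 h tendsto_id) ?_
  filter_upwards [eventually_ge_atTop τ] with t ht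
  exact le_integral_fundamentalSolution_sq hτ ht

/-! ### Fundamental solution: increments and the semigroup identity -/

theorem fundamentalSolution_sub_eq_integral {b τ u v : ℝ} (hτ : 0 < τ) (hu : 0 ≤ u) (hv : 0 ≤ v) :
    fundamentalSolution b τ v - fundamentalSolution b τ u
      = ∫ s in u..v, b * fundamentalSolution b τ (s - τ) := by
  have hi := intervalIntegrable_fundamentalSolution_sub (b := b) hτ
  rw [fundamentalSolution_eq_one_add_integral hτ hu, fundamentalSolution_eq_one_add_integral hτ hv,
    ← intervalIntegral.integral_add_adjacent_intervals (hi 0 u) (hi u v)]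
  ring

/-- The fundamental solution on `[a, ∞)`, expressed through its values on `[a - τ, a]`. -/
theorem fundamentalSolution_add {b τ a t : ℝ} (hτ : 0 < τ) (ha : τ ≤ a) (ht : 0 ≤ t) :
    fundamentalSolution b τ (a + t) = fundamentalSolution b τ t * fundamentalSolution b τ a
      + ∫ r in (-τ)..0, b * fundamentalSolution b τ (t - τ - r)
          * fundamentalSolution b τ (a + r) := by
  -- The shifted path `s ↦ X(a + s)` solves the noiseless equation; `τ ≤ a` keeps its arguments in
  -- `[0, ∞)`, where `X` is continuous.
  have h := delay_variation_of_constants (b := b) (y₀ := fundamentalSolution b τ a) hτ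
    (y := fun s => fundamentalSolution b τ (a + s)) (η := fun _ => 0)
    ((continuousOn_fundamentalSolution hτ).comp (by fun_prop) fun s hs => by
      rw [mem_Ici] at hs ⊢
      linarith) (fun s hs => by
      have h1 := fundamentalSolution_sub_eq_integral (b := b) hτ (by linarith : 0 ≤ a)
        (by linarith : 0 ≤ a + s)
      have h2 := intervalIntegral.integral_comp_add_left (a := 0) (b := s)
        (fun q => b * fundamentalSolution b τ (q - τ)) a
      rw [add_zero] at h2
      simp only [← add_sub_assoc, h2, ← h1]
      ring) ht
  simpa using h

theorem delayTerm_of_le {b τ s : ℝ} {k : ℕ} (h : k * τ ≤ s) :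
    delayTerm b τ k s = b ^ k / (k.factorial : ℝ) * (s - k * τ) ^ k :=
  indicator_of_mem (mem_Ici.2 h) _

/-- At `s = kτ` the power vanishes as `k ≠ 0`; this lets the explicit formulas hold on closed
intervals. -/
theorem delayTerm_of_ge {b τ s : ℝ} {k : ℕ} (hk : k ≠ 0) (h : s ≤ k * τ) :
    delayTerm b τ k s = 0 := by
  rcases h.lt_or_eq with h | h
  · exact indicator_of_notMem (by rw [mem_Ici]; linarith) _
  · rw [delayTerm_of_le h.ge, h, sub_self, zero_pow hk, mul_zero]

/-! ### The example `b = -1`, `τ = 1` -/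

theorem fundamentalSolution_neg_one_of_mem_Icc_one_two {t : ℝ} (ht : t ∈ Icc 1 2) :
    fundamentalSolution (-1) 1 t = 2 - t := by
  rw [fundamentalSolution_eq_sum_delayTerm one_pos 3 (by norm_num; linarith [ht.2]),
    Finset.sum_range_succ, Finset.sum_range_succ, Finset.sum_range_one,
    delayTerm_of_le (by norm_num; linarith [ht.1]), delayTerm_of_le (by norm_num; linarith [ht.1]),
    delayTerm_of_ge two_ne_zero (by norm_num; linarith [ht.2])]
  norm_num
  ring

theorem fundamentalSolution_neg_one_of_mem_Icc_two_three {t : ℝ} (ht : t ∈ Icc 2 3) :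
    fundamentalSolution (-1) 1 t = 2 - t + (t - 2) ^ 2 / 2 := by
  rw [fundamentalSolution_eq_sum_delayTerm one_pos 4 (by norm_num; linarith [ht.2]),
    Finset.sum_range_succ, Finset.sum_range_succ, Finset.sum_range_succ, Finset.sum_range_one,
    delayTerm_of_le (by norm_num; linarith [ht.1]), delayTerm_of_le (by norm_num; linarith [ht.1]),
    delayTerm_of_le (by norm_num; linarith [ht.1]),
    delayTerm_of_ge three_ne_zero (by norm_num; linarith [ht.2])]
  norm_num [Nat.factorial]
  ring

theorem fundamentalSolution_neg_one_of_mem_Icc_three_four {t : ℝ} (ht : t ∈ Icc 3 4) :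
    fundamentalSolution (-1) 1 t = 2 - t + (t - 2) ^ 2 / 2 - (t - 3) ^ 3 / 6 := by
  rw [fundamentalSolution_eq_sum_delayTerm one_pos 5 (by norm_num; linarith [ht.2]),
    Finset.sum_range_succ, Finset.sum_range_succ, Finset.sum_range_succ, Finset.sum_range_succ,
    Finset.sum_range_one,
    delayTerm_of_le (by norm_num; linarith [ht.1]), delayTerm_of_le (by norm_num; linarith [ht.1]),
    delayTerm_of_le (by norm_num; linarith [ht.1]), delayTerm_of_le (by norm_num; linarith [ht.1]),
    delayTerm_of_ge four_ne_zero (by norm_num; linarith [ht.2])]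
  norm_num [Nat.factorial]
  ring

theorem abs_fundamentalSolution_neg_one_le_one_of_le_four {t : ℝ} (ht : t ∈ Icc 0 4) :
    |fundamentalSolution (-1) 1 t| ≤ 1 := by
  obtain ⟨h0, h4⟩ := ht
  rcases le_total t 1 with h1 | h1
  · rw [fundamentalSolution_of_mem_Icc one_pos ⟨h0, h1⟩, abs_one]
  rcases le_total t 2 with h2 | h2
  · rw [fundamentalSolution_neg_one_of_mem_Icc_one_two ⟨h1, h2⟩, abs_le]
    constructor <;> linarith
  rcases le_total t 3 with h3 | h3
  · rw [fundamentalSolution_neg_one_of_mem_Icc_two_three ⟨h2, h3⟩, abs_le]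
    constructor <;> nlinarith
  · rw [fundamentalSolution_neg_one_of_mem_Icc_three_four ⟨h3, h4⟩, abs_le]
    have e1 : 0 ≤ t - 3 := by linarith
    have e2 : t - 3 ≤ 1 := by linarith
    have e3 : (t - 3) ^ 3 ≤ 1 := pow_le_one₀ e1 e2
    have e4 : 0 ≤ (t - 3) ^ 3 := pow_nonneg e1 3
    constructor <;> nlinarith

/-- In `fundamentalSolution_add` with step `3`, the point value has weight `|X(3)| = 1/2`, and the
kernel `-X(2 - r) = -r - r²/2 ≥ 0` has integral `1/3` over `[-1, 0]`; the total is `5/6`. -/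
theorem abs_fundamentalSolution_neg_one_le_mul {a M : ℝ} (ha : 1 ≤ a)
    (hM : ∀ s ∈ Icc (a - 1) a, |fundamentalSolution (-1) 1 s| ≤ M) :
    |fundamentalSolution (-1) 1 (a + 3)| ≤ 5 / 6 * M := by
  have h := fundamentalSolution_add (b := -1) one_pos ha (by norm_num : (0 : ℝ) ≤ 3)
  have h3 : fundamentalSolution (-1) 1 3 = -(1 / 2) := by
    rw [fundamentalSolution_neg_one_of_mem_Icc_two_three ⟨by norm_num, le_rfl⟩]
    norm_num
  have hint : |∫ r in (-1 : ℝ)..0, -1 * fundamentalSolution (-1) 1 (3 - 1 - r)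
      * fundamentalSolution (-1) 1 (a + r)| ≤ ∫ r in (-1 : ℝ)..0, (-r - r ^ 2 / 2) * M := by
    rw [← Real.norm_eq_abs]
    refine intervalIntegral.norm_integral_le_of_norm_le (by norm_num)
      (ae_of_all _ fun r hr => ?_) (Continuous.intervalIntegrable (by fun_prop) _ _)
    have hr1 := hr.1
    have hr2 := hr.2
    have hnn : 0 ≤ -r - r ^ 2 / 2 := by nlinarith
    rw [fundamentalSolution_neg_one_of_mem_Icc_two_three ⟨by linarith, by linarith⟩, norm_mul,
      show -1 * (2 - (3 - 1 - r) + (3 - 1 - r - 2) ^ 2 / 2) = -r - r ^ 2 / 2 by ring,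
      Real.norm_of_nonneg hnn]
    exact mul_le_mul_of_nonneg_left (hM _ ⟨by linarith, by linarith⟩) hnn
  have hval : ∫ r in (-1 : ℝ)..0, (-r - r ^ 2 / 2) * M = 1 / 3 * M := by
    rw [intervalIntegral.integral_mul_const, intervalIntegral.integral_sub
      (Continuous.intervalIntegrable (by fun_prop) _ _)
      (Continuous.intervalIntegrable (by fun_prop) _ _), intervalIntegral.integral_neg,
      intervalIntegral.integral_div, integral_id, integral_pow]
    norm_num
  rw [hval] at hint
  rw [h, h3]
  have hMa := hM a ⟨by linarith, le_rfl⟩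
  refine (abs_add_le _ _).trans ?_
  rw [abs_mul, abs_neg, abs_of_pos (by norm_num : (0 : ℝ) < 1 / 2)]
  linarith

theorem abs_fundamentalSolution_neg_one_le_one {t : ℝ} (ht : 0 ≤ t) :
    |fundamentalSolution (-1) 1 t| ≤ 1 := by
  have key : ∀ n : ℕ, ∀ t ∈ Icc (0 : ℝ) (n + 4), |fundamentalSolution (-1) 1 t| ≤ 1 := by
    intro n
    induction n with
    | zero => intro t ht; exact abs_fundamentalSolution_neg_one_le_one_of_le_four (by simpa using ht)
    | succ n ih =>
      intro t ht
      rcases le_total t (n + 4) with h | h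
      · exact ih t ⟨ht.1, h⟩
      · have hn : (0 : ℝ) ≤ n := n.cast_nonneg
        have h2 := ht.2
        push_cast at h2
        -- The window `[t - 4, t - 3]` lies in the range already treated.
        have := abs_fundamentalSolution_neg_one_le_mul (a := t - 3) (M := 1) (by linarith)
          (fun s hs => ih s ⟨by linarith [hs.1], by linarith [hs.2]⟩)
        rw [sub_add_cancel] at this
        linarith
  obtain ⟨n, hn⟩ := exists_nat_ge t
  exact key n t ⟨ht, by linarith⟩

/-- A step of `3` plus a window of length `1`: every `4` units of time gain a factor `5/6`. -/
theorem abs_fundamentalSolution_neg_one_le_pow (n : ℕ) {t : ℝ} (ht : 4 * n ≤ t) :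
    |fundamentalSolution (-1) 1 t| ≤ (5 / 6) ^ n := by
  induction n generalizing t with
  | zero => simpa using abs_fundamentalSolution_neg_one_le_one (by simpa using ht)
  | succ n ih =>
    push_cast at ht
    have hn : (0 : ℝ) ≤ n := n.cast_nonneg
    have := abs_fundamentalSolution_neg_one_le_mul (a := t - 3) (by linarith)
      (fun s hs => ih (t := s) (by linarith [hs.1]))
    rw [sub_add_cancel] at this
    rw [pow_succ, mul_comm]
    exact this

/-- On `[4k, 4k + 4]` the integrand is at most `(25/36)^k`, and the geometric series sums to `4 ·
36/11 = 144/11`. -/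
theorem integral_fundamentalSolution_neg_one_sq_le (n : ℕ) :
    ∫ q in (0 : ℝ)..(4 * n : ℝ), fundamentalSolution (-1) 1 q ^ 2 ≤ 144 / 11 := by
  have hi : ∀ k : ℕ, IntervalIntegrable (fun q => fundamentalSolution (-1) 1 q ^ 2) volume
      (4 * k : ℝ) (4 * (k + 1 : ℕ) : ℝ) := fun k =>
    intervalIntegrable_fundamentalSolution_sq one_pos (by positivity) (by positivity)
  have hs := intervalIntegral.sum_integral_adjacent_intervals (a := fun k : ℕ => (4 * k : ℝ))
    (n := n) (fun k _ => hi k)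
  simp only [Nat.cast_zero, mul_zero] at hs
  rw [← hs]
  have hle : ∀ k ∈ Finset.range n, ∫ q in (4 * k : ℝ)..(4 * (k + 1 : ℕ) : ℝ),
      fundamentalSolution (-1) 1 q ^ 2 ≤ 4 * (25 / 36) ^ k := by
    intro k _
    have hk : (4 * k : ℝ) ≤ 4 * (k + 1 : ℕ) := by push_cast; linarith
    refine (intervalIntegral.integral_mono_on hk (hi k) (g := fun _ => (25 / 36 : ℝ) ^ k)
      (by simp) fun q hq => ?_).trans_eq ?_
    · rw [← sq_abs, show (25 / 36 : ℝ) = (5 / 6) ^ 2 by norm_num, ← pow_mul, mul_comm 2 k, pow_mul]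
      exact pow_le_pow_left₀ (abs_nonneg _) (abs_fundamentalSolution_neg_one_le_pow k hq.1) 2
    · rw [intervalIntegral.integral_const, smul_eq_mul]
      push_cast
      ring
  refine (Finset.sum_le_sum hle).trans ?_
  rw [← Finset.mul_sum, geom_sum_eq (by norm_num)]
  have h0 : (0 : ℝ) ≤ (25 / 36) ^ n := by positivity
  rw [show (25 / 36 - 1 : ℝ) = -(11 / 36) by norm_num, div_neg, ← neg_div, neg_sub, ← mul_div_assoc,
    div_le_div_iff₀ (by norm_num) (by norm_num)]
  linarith

theorem tendsto_four_mul_natCast : Tendsto (fun n : ℕ => (4 * n : ℝ)) atTop atTop :=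
  tendsto_natCast_atTop_atTop.const_mul_atTop (by norm_num)

theorem integrableOn_fundamentalSolution_neg_one_sq :
    IntegrableOn (fun q => fundamentalSolution (-1) 1 q ^ 2) (Ioi 0) := by
  refine integrableOn_Ioi_of_intervalIntegral_norm_bounded (144 / 11) 0 (l := atTop)
    (fun n : ℕ => ?_) tendsto_four_mul_natCast (Eventually.of_forall fun n => ?_)
  · exact (intervalIntegrable_fundamentalSolution_sq (b := -1) one_pos le_rfl
      (by positivity : (0 : ℝ) ≤ 4 * n)).1
  · simpa using integral_fundamentalSolution_neg_one_sq_le n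

theorem stationaryVariance_neg_one_le : stationaryVariance (-1) 1 (1 / 4) ≤ 9 / 11 := by
  have h : ∫ q in Ioi (0 : ℝ), fundamentalSolution (-1) 1 q ^ 2 ≤ 144 / 11 :=
    le_of_tendsto (intervalIntegral_tendsto_integral_Ioi 0
      integrableOn_fundamentalSolution_neg_one_sq tendsto_four_mul_natCast)
      (Eventually.of_forall integral_fundamentalSolution_neg_one_sq_le)
  unfold stationaryVariance
  linarith

/-- Here `X` is `1` up to time `1` and `2 - q` on `[1, 1 + t]`. The value expands to `1 + t/16 - t²
+ t³/3`, which first rises and then falls. -/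
theorem totalVariance_neg_one {t : ℝ} (ht : t ∈ Icc 0 1) :
    totalVariance (-1) 1 (1 / 4) 1 t = (1 - t) + (1 - (1 - t) ^ 3) / 3 + t / 16 := by
  have hi : ∀ u v : ℝ, 0 ≤ u → 0 ≤ v →
      IntervalIntegrable (fun q => fundamentalSolution (-1) 1 q ^ 2) volume u v :=
    fun u v => intervalIntegrable_fundamentalSolution_sq one_pos
  have a1 := intervalIntegral.integral_add_adjacent_intervals (hi 0 t le_rfl ht.1)
    (hi t 1 ht.1 zero_le_one)
  have a2 := intervalIntegral.integral_add_adjacent_intervals (hi t 1 ht.1 zero_le_one)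
    (hi 1 (t + 1) zero_le_one (by linarith [ht.1]))
  rw [integral_fundamentalSolution_sq_eq one_pos ht,
    integral_fundamentalSolution_sq_eq one_pos ⟨zero_le_one, le_rfl⟩] at a1
  have a3 : ∫ q in (1 : ℝ)..(t + 1), fundamentalSolution (-1) 1 q ^ 2
      = (1 - (1 - t) ^ 3) / 3 := by
    have e : ∫ q in (1 : ℝ)..(t + 1), fundamentalSolution (-1) 1 q ^ 2
        = ∫ q in (1 : ℝ)..(t + 1), (2 - q) ^ 2 := by
      refine intervalIntegral.integral_congr fun q hq => ?_
      rw [uIcc_of_le (by linarith [ht.1])] at hq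
      rw [fundamentalSolution_neg_one_of_mem_Icc_one_two ⟨hq.1, by linarith [hq.2, ht.2]⟩]
    rw [e, intervalIntegral.integral_comp_sub_left (fun q => q ^ 2), integral_pow]
    norm_num
    ring
  rw [totalVariance_eq one_pos (by norm_num) ht.1, deterministicVariance, noiseVariance, ← a2, a3,
    integral_fundamentalSolution_sq_eq one_pos ht, show ∫ q in t..1,
      fundamentalSolution (-1) 1 q ^ 2 = 1 - t by linarith]
  ring

theorem totalVariance_neg_one_zero : totalVariance (-1) 1 (1 / 4) 1 0 = 1 := by
  rw [totalVariance_neg_one ⟨le_rfl, zero_le_one⟩]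
  norm_num

theorem one_lt_totalVariance_neg_one : 1 < totalVariance (-1) 1 (1 / 4) 1 (1 / 32) := by
  rw [totalVariance_neg_one ⟨by norm_num, by norm_num⟩]
  norm_num

theorem totalVariance_neg_one_quarter_mem_Ioo :
    totalVariance (-1) 1 (1 / 4) 1 (1 / 4) ∈ Ioo (9 / 11 : ℝ) 1 := by
  rw [totalVariance_neg_one ⟨by norm_num, by norm_num⟩]
  constructor <;> norm_num

theorem not_monotoneOn_and_not_antitoneOn_of_peak {f : ℝ → ℝ} {S : Set ℝ} {x y z : ℝ} (hx : x ∈ S)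
    (hy : y ∈ S) (hz : z ∈ S) (hxy : x ≤ y) (hyz : y ≤ z) (h1 : f x < f y) (h2 : f z < f y) :
    ¬ MonotoneOn f S ∧ ¬ AntitoneOn f S :=
  ⟨fun h => h2.not_ge (h hy hz hyz), fun h => h1.not_ge (h hx hy hxy)⟩

theorem not_monotoneOn_and_not_antitoneOn_of_valley {f : ℝ → ℝ} {S : Set ℝ} {x y z : ℝ} (hx : x ∈ S)
    (hy : y ∈ S) (hz : z ∈ S) (hxy : x ≤ y) (hyz : y ≤ z) (h1 : f y < f x) (h2 : f y < f z) :
    ¬ MonotoneOn f S ∧ ¬ AntitoneOn f S :=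
  ⟨fun h => h1.not_ge (h hx hy hxy), fun h => h2.not_ge (h hy hz hyz)⟩

theorem gibbsEntropy_gaussianPDFReal_lt {v w : ℝ} (hv : 0 < v) (hvw : v < w) :
    gibbsEntropy (gaussianPDFReal 0 v.toNNReal) < gibbsEntropy (gaussianPDFReal 0 w.toNNReal) := by
  rw [gibbsEntropy_gaussianPDFReal hv, gibbsEntropy_gaussianPDFReal (hv.trans hvw)]
  have := Real.log_lt_log (by positivity) (mul_lt_mul_of_pos_left hvw Real.two_pi_pos)
  linarith

/-- Above the variance of the reference Gaussian, the conditional entropy decreases with the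
variance. -/
theorem conditionalEntropy_gaussianPDFReal_lt {s v w : ℝ} (hs : 0 < s) (hsv : s ≤ v) (hvw : v < w) :
    conditionalEntropy (gaussianPDFReal 0 w.toNNReal) (gaussianPDFReal 0 s.toNNReal)
      < conditionalEntropy (gaussianPDFReal 0 v.toNNReal) (gaussianPDFReal 0 s.toNNReal) := by
  have hv : 0 < v := hs.trans_le hsv
  have hw : 0 < w := hv.trans hvw
  rw [conditionalEntropy_gaussianPDFReal hv hs, conditionalEntropy_gaussianPDFReal hw hs,
    Real.log_div hv.ne' hs.ne', Real.log_div hw.ne' hs.ne']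
  have h1 : Real.log (w / v) < w / v - 1 :=
    Real.log_lt_sub_one_of_pos (by positivity) (by rw [ne_eq, div_eq_one_iff_eq hv.ne']; exact hvw.ne')
  rw [Real.log_div hw.ne' hv.ne'] at h1
  -- The place where `s ≤ v` enters: `(w - v)/v ≤ (w - v)/s`.
  have h2 : w / v - 1 ≤ w / s - v / s := by
    rw [div_sub_one hv.ne', ← sub_div]
    exact div_le_div_of_nonneg_left (by linarith) hs hsv
  linarith

theorem not_monotone_neg_one :
    (¬ MonotoneOn (fun t => totalVariance (-1) 1 (1 / 4) 1 t) (Ici 0) ∧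
        ¬ AntitoneOn (fun t => totalVariance (-1) 1 (1 / 4) 1 t) (Ici 0)) ∧
      (¬ MonotoneOn (fun t => gibbsEntropy (solutionDensity (-1) 1 (1 / 4) 1 t)) (Ici 0) ∧
        ¬ AntitoneOn (fun t => gibbsEntropy (solutionDensity (-1) 1 (1 / 4) 1 t)) (Ici 0)) ∧
      (¬ MonotoneOn (fun t => conditionalEntropy (solutionDensity (-1) 1 (1 / 4) 1 t)
          (stationaryDensity (-1) 1 (1 / 4))) (Ici 0) ∧
        ¬ AntitoneOn (fun t => conditionalEntropy (solutionDensity (-1) 1 (1 / 4) 1 t)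
          (stationaryDensity (-1) 1 (1 / 4))) (Ici 0)) := by
  have m0 : (0 : ℝ) ∈ Ici (0 : ℝ) := mem_Ici.2 le_rfl
  have m1 : (1 / 32 : ℝ) ∈ Ici (0 : ℝ) := mem_Ici.2 (by norm_num)
  have m2 : (1 / 4 : ℝ) ∈ Ici (0 : ℝ) := mem_Ici.2 (by norm_num)
  have l0 : (0 : ℝ) ≤ 1 / 32 := by norm_num
  have l1 : (1 / 32 : ℝ) ≤ 1 / 4 := by norm_num
  have hs := stationaryVariance_pos one_pos (by norm_num : (0 : ℝ) < 1 / 4)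
    integrableOn_fundamentalSolution_neg_one_sq
  have hs' := stationaryVariance_neg_one_le
  obtain ⟨hq, hq1⟩ := totalVariance_neg_one_quarter_mem_Ioo
  have v0 := totalVariance_neg_one_zero
  have h1 : totalVariance (-1) 1 (1 / 4) 1 0 < totalVariance (-1) 1 (1 / 4) 1 (1 / 32) :=
    v0.trans_lt one_lt_totalVariance_neg_one
  have h2 : totalVariance (-1) 1 (1 / 4) 1 (1 / 4) < totalVariance (-1) 1 (1 / 4) 1 (1 / 32) :=
    hq1.trans one_lt_totalVariance_neg_one
  exact ⟨not_monotoneOn_and_not_antitoneOn_of_peak m0 m1 m2 l0 l1 h1 h2,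
    not_monotoneOn_and_not_antitoneOn_of_peak m0 m1 m2 l0 l1
      (gibbsEntropy_gaussianPDFReal_lt (by linarith) h1)
      (gibbsEntropy_gaussianPDFReal_lt (by linarith) h2),
    not_monotoneOn_and_not_antitoneOn_of_valley m0 m1 m2 l0 l1
      (conditionalEntropy_gaussianPDFReal_lt hs (by linarith) h1)
      (conditionalEntropy_gaussianPDFReal_lt hs (by linarith) h2)⟩

/-! ### The law of the solution -/

/-- This telescopes the Wiener weight `c + ∫ₛᵀ g` to a single value of `X`; `T ≤ a + τ` keeps the
arguments nonnegative. -/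
theorem integral_fundamentalSolution_const_sub {b τ a s T : ℝ} (hτ : 0 < τ) (hs : s ≤ T)
    (hT : T ≤ a + τ) :
    ∫ u in s..T, b * fundamentalSolution b τ (a - u)
      = fundamentalSolution b τ (a + τ - s) - fundamentalSolution b τ (a + τ - T) := by
  rw [fundamentalSolution_sub_eq_integral hτ (by linarith) (by linarith),
    ← intervalIntegral.integral_comp_sub_left (fun q => b * fundamentalSolution b τ (q - τ))]
  refine intervalIntegral.integral_congr fun u _ => ?_
  rw [show a + τ - u - τ = a - u by ring]

section DelaySolution

variable {Ω : Type*} [MeasurableSpace Ω] {P : Measure Ω}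

/-- Variation of constants with `η = σ w`; the initial segment is shifted to `[0, τ]`, the time
interval of `W`. -/
theorem IsDelaySolution.ae_eq {b τ σ : ℝ} (hτ : 0 < τ) {ξ : ℝ → Ω → ℝ} {w : ℝ≥0 → Ω → ℝ}
    {x : ℝ → Ω → ℝ} (h : IsDelaySolution P b τ σ ξ w x) {t : ℝ} (ht : 0 ≤ t) :
    ∀ᵐ ω ∂P, x t ω = (fundamentalSolution b τ t * ξ 0 ω
        + ∫ s in (0 : ℝ)..τ, b * fundamentalSolution b τ (t - s) * ξ (s - τ) ω)
      + (σ * w t.toNNReal ω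
        + ∫ s in (0 : ℝ)..t, b * fundamentalSolution b τ (t - τ - s) * (σ * w s.toNNReal ω)) := by
  filter_upwards [h] with ω ⟨hc, hξ, heq⟩
  rw [delay_variation_of_constants hτ hc heq ht]
  congr 2
  have e := intervalIntegral.integral_comp_sub_right (a := 0) (b := τ)
    (fun r => b * fundamentalSolution b τ (t - τ - r) * x r ω) τ
  rw [zero_sub, sub_self] at e
  rw [← e]
  refine intervalIntegral.integral_congr fun s hs => ?_
  rw [uIcc_of_le hτ.le] at hs
  rw [hξ _ ⟨by linarith [hs.1], by linarith [hs.2]⟩, show t - τ - (s - τ) = t - s by ring]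

variable {b τ σ σbar t : ℝ} {W w : ℝ≥0 → Ω → ℝ} {x z : ℝ → Ω → ℝ}

theorem IsDelaySolution.noiseless_ae_eq (hτ : 0 < τ) {ξ : ℝ → Ω → ℝ}
    (hz : IsDelaySolution P b τ 0 ξ w z) (ht : 0 ≤ t) :
    ∀ᵐ ω ∂P, z t ω = fundamentalSolution b τ t * ξ 0 ω
      + ∫ s in (0 : ℝ)..τ, b * fundamentalSolution b τ (t - s) * ξ (s - τ) ω := by
  filter_upwards [hz.ae_eq hτ ht] with ω hω
  simpa using hω

theorem IsDelaySolution.sub_noiseless_ae_eq (hτ : 0 < τ) {ξ : ℝ → Ω → ℝ}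
    (hx : IsDelaySolution P b τ σ ξ w x) (hz : IsDelaySolution P b τ 0 ξ w z) (ht : 0 ≤ t) :
    ∀ᵐ ω ∂P, x t ω - z t ω = σ * w t.toNNReal ω
      + ∫ s in (0 : ℝ)..t, σ * (b * fundamentalSolution b τ (t - τ - s)) * w s.toNNReal ω := by
  filter_upwards [hx.ae_eq hτ ht, hz.noiseless_ae_eq hτ ht] with ω h1 h2
  rw [h1, h2, add_sub_cancel_left]
  congr 1
  exact intervalIntegral.integral_congr fun s _ => by ring

theorem hasLaw_noiseless (hτ : 0 < τ) (hW : IsBrownianReal W P)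
    (hz : IsDelaySolution P b τ 0 (brownianInitial τ σbar W) w z) (ht : 0 ≤ t) :
    HasLaw (z t) (gaussianReal 0 (deterministicVariance b τ σbar t).toNNReal) P := by
  have h := hW.hasLaw_pathFunctional hτ.le (σbar * fundamentalSolution b τ t)
    ((intervalIntegrable_fundamentalSolution_const_sub (b := b) hτ t 0 τ).const_mul σbar)
  -- The weight is `σbar X(t + τ - s)`, and the substitution `q = t + τ - s` maps `[0, τ]` to `[t, t
  -- + τ]`.
  have hvar : ∫ s in (0 : ℝ)..τ, (σbar * fundamentalSolution b τ t
        + ∫ u in s..τ, σbar * (b * fundamentalSolution b τ (t - u))) ^ 2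
      = deterministicVariance b τ σbar t := by
    have e := intervalIntegral.integral_comp_sub_left (a := 0) (b := τ)
      (fun q => σbar ^ 2 * fundamentalSolution b τ q ^ 2) (t + τ)
    rw [add_sub_cancel_right, sub_zero] at e
    rw [deterministicVariance, ← intervalIntegral.integral_const_mul, ← e]
    refine intervalIntegral.integral_congr fun s hs => ?_
    rw [uIcc_of_le hτ.le] at hs
    rw [intervalIntegral.integral_const_mul,
      integral_fundamentalSolution_const_sub hτ hs.2 (by linarith), add_sub_cancel_right]
    ring
  rw [hvar] at h
  refine h.congr ?_
  filter_upwards [hz.noiseless_ae_eq hτ ht] with ω hω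
  rw [hω]
  simp only [brownianInitial, zero_add, sub_add_cancel]
  congr 1
  · ring
  · exact intervalIntegral.integral_congr fun s _ => by ring

theorem hasLaw_sub_noiseless (hτ : 0 < τ) {ξ : ℝ → Ω → ℝ} (hw : IsBrownianReal w P)
    (hx : IsDelaySolution P b τ σ ξ w x) (hz : IsDelaySolution P b τ 0 ξ w z) (ht : 0 ≤ t) :
    HasLaw (fun ω => x t ω - z t ω) (gaussianReal 0 (noiseVariance b τ σ t).toNNReal) P := by
  have h := hw.hasLaw_pathFunctional ht σ
    ((intervalIntegrable_fundamentalSolution_const_sub (b := b) hτ (t - τ) 0 t).const_mul σ)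
  -- The weight is `σ X(t - s)`: the constant `σ` cancels the boundary term `σ X(0)`.
  have hvar : ∫ s in (0 : ℝ)..t, (σ
        + ∫ u in s..t, σ * (b * fundamentalSolution b τ (t - τ - u))) ^ 2
      = noiseVariance b τ σ t := by
    have e := intervalIntegral.integral_comp_sub_left (a := 0) (b := t)
      (fun q => σ ^ 2 * fundamentalSolution b τ q ^ 2) t
    rw [sub_self, sub_zero] at e
    rw [noiseVariance, ← intervalIntegral.integral_const_mul, ← e]
    refine intervalIntegral.integral_congr fun s hs => ?_
    rw [uIcc_of_le ht] at hs
    rw [intervalIntegral.integral_const_mul,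
      integral_fundamentalSolution_const_sub hτ hs.2 (by linarith), sub_add_cancel, sub_self,
      fundamentalSolution_zero hτ]
    ring
  rw [hvar] at h
  exact h.congr (hx.sub_noiseless_ae_eq hτ hz ht)

theorem indepFun_noiseless_sub (hτ : 0 < τ) (hW : IsBrownianReal W P) (hw : IsBrownianReal w P)
    (hind : IndepFun (fun ω (s : Icc (-τ) (0 : ℝ)) => brownianInitial τ σbar W s ω)
      (fun ω (t : ℝ≥0) => w t ω) P)
    (hx : IsDelaySolution P b τ σ (brownianInitial τ σbar W) w x)
    (hz : IsDelaySolution P b τ 0 (brownianInitial τ σbar W) w z) (ht : 0 ≤ t) :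
    IndepFun (z t) (fun ω => x t ω - z t ω) P := by
  have hle : -τ ≤ 0 := by linarith
  -- The initial path is indexed by a subtype, so `projIcc` makes the time `s - τ` an index for
  -- every real `s`.
  obtain ⟨Φ, hΦm, hΦ⟩ := exists_measurable_pathFunctional
    (fun s => projIcc (-τ) 0 hle (s - τ)) (fundamentalSolution b τ t) hτ.le
    (intervalIntegrable_fundamentalSolution_const_sub (b := b) hτ t 0 τ)
  obtain ⟨Ψ, hΨm, hΨ⟩ := exists_measurable_pathFunctional Real.toNNReal σ ht
    ((intervalIntegrable_fundamentalSolution_const_sub (b := b) hτ (t - τ) 0 t).const_mul σ)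
  refine (hind.comp hΦm hΨm).congr ?_ ?_
  · filter_upwards [hW.cont, hz.noiseless_ae_eq hτ ht] with ω hc hω
    have hp : ∀ s ∈ Icc 0 τ, ((projIcc (-τ) 0 hle (s - τ) : Icc (-τ) (0 : ℝ)) : ℝ) = s - τ :=
      fun s hs => by rw [projIcc_of_mem hle ⟨by linarith [hs.1], by linarith [hs.2]⟩]
    rw [Function.comp_apply, hΦ _ ?_, hω, hp τ ⟨hτ.le, le_rfl⟩, sub_self]
    · congr 1
      refine intervalIntegral.integral_congr fun s hs => ?_
      rw [uIcc_of_le hτ.le] at hs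
      simp only [hp s hs]
    · simp only [brownianInitial]
      fun_prop
  · filter_upwards [hw.cont, hx.sub_noiseless_ae_eq hτ hz ht] with ω hc hω
    rw [Function.comp_apply, hΨ _ (by fun_prop), hω]

theorem hasLaw_delaySolution (hτ : 0 < τ) (hσ : 0 < σ) (hW : IsBrownianReal W P)
    (hw : IsBrownianReal w P)
    (hind : IndepFun (fun ω (s : Icc (-τ) (0 : ℝ)) => brownianInitial τ σbar W s ω)
      (fun ω (t : ℝ≥0) => w t ω) P)
    (hx : IsDelaySolution P b τ σ (brownianInitial τ σbar W) w x)
    (hz : IsDelaySolution P b τ 0 (brownianInitial τ σbar W) w z) (ht : 0 ≤ t) :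
    HasLaw (x t) (gaussianReal 0 (totalVariance b τ σ σbar t).toNNReal) P := by
  have h1 := hasLaw_noiseless hτ hW hz ht
  have h2 := hasLaw_sub_noiseless hτ hw hx hz ht
  have e : x t = z t + fun ω => x t ω - z t ω := by
    ext ω
    simp
  rw [e]
  refine ⟨h1.aemeasurable.add h2.aemeasurable, ?_⟩
  rw [gaussianReal_add_gaussianReal_of_indepFun (indepFun_noiseless_sub hτ hW hw hind hx hz ht)
    h1.map_eq h2.map_eq, add_zero, totalVariance_eq hτ hσ ht,
    Real.toNNReal_add (deterministicVariance_nonneg b σbar t hτ) (noiseVariance_nonneg b τ σ ht)]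

end DelaySolution

theorem mainTheorem5 :
    (∀ b τ σ σbar : ℝ, 0 < τ → 0 < σ → 0 < σbar →
      IsFundamentalSolution b τ (fundamentalSolution b τ) ∧
      -- the law of the solution and of its deterministic and noise parts
      (∀ (Ω : Type*) [MeasurableSpace Ω] (P : Measure Ω) [IsProbabilityMeasure P]
          (W w : ℝ≥0 → Ω → ℝ) (x z : ℝ → Ω → ℝ),
        IsBrownianReal W P → IsBrownianReal w P →
        IndepFun (fun ω (s : Icc (-τ) (0 : ℝ)) => brownianInitial τ σbar W s ω)
          (fun ω (t : ℝ≥0) => w t ω) P →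
        IsDelaySolution P b τ σ (brownianInitial τ σbar W) w x →
        IsDelaySolution P b τ 0 (brownianInitial τ σbar W) w z →
        ∀ t, 0 ≤ t →
          HasLaw (z t) (gaussianReal 0 (deterministicVariance b τ σbar t).toNNReal) P ∧
          HasLaw (fun ω => x t ω - z t ω) (gaussianReal 0 (noiseVariance b τ σ t).toNNReal) P ∧
          IndepFun (z t) (fun ω => x t ω - z t ω) P ∧
          HasLaw (x t) (gaussianReal 0 (totalVariance b τ σ σbar t).toNNReal) P ∧
          P.map (x t)
            = volume.withDensity (fun u => ENNReal.ofReal (solutionDensity b τ σ σbar t u))) ∧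
      -- the variance and the Gibbs entropy
      (∀ t, 0 ≤ t →
        0 < totalVariance b τ σ σbar t ∧
        totalVariance b τ σ σbar t
          = deterministicVariance b τ σbar t + noiseVariance b τ σ t ∧
        Integrable (fun u => solutionDensity b τ σ σbar t u
          * Real.log (solutionDensity b τ σ σbar t u)) ∧
        gibbsEntropy (solutionDensity b τ σ σbar t)
          = 1 / 2 + 1 / 2 * Real.log (2 * Real.pi * totalVariance b τ σ σbar t)) ∧
      -- the conditional entropy, when the stationary density exists
      (IntegrableOn (fun q => fundamentalSolution b τ q ^ 2) (Ioi 0) →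
        0 < stationaryVariance b τ σ ∧
        (∀ u, Tendsto (fun t => solutionDensity b τ σ σbar t u) atTop
          (𝓝 (stationaryDensity b τ σ u))) ∧
        ∀ t, 0 ≤ t →
          Integrable (fun u => solutionDensity b τ σ σbar t u
            * Real.log (solutionDensity b τ σ σbar t u / stationaryDensity b τ σ u)) ∧
          conditionalEntropy (solutionDensity b τ σ σbar t) (stationaryDensity b τ σ)
            = 1 / 2 * Real.log (totalVariance b τ σ σbar t / stationaryVariance b τ σ)
              + 1 / 2 * (1 - totalVariance b τ σ σbar t / stationaryVariance b τ σ))) ∧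
    -- lack of monotonicity for `b = -1`, `τ = σbar = 1`, `σ = 1/4`
    (IntegrableOn (fun q => fundamentalSolution (-1) 1 q ^ 2) (Ioi 0) ∧
      (¬ MonotoneOn (fun t => totalVariance (-1) 1 (1 / 4) 1 t) (Ici 0) ∧
        ¬ AntitoneOn (fun t => totalVariance (-1) 1 (1 / 4) 1 t) (Ici 0)) ∧
      (¬ MonotoneOn (fun t => gibbsEntropy (solutionDensity (-1) 1 (1 / 4) 1 t)) (Ici 0) ∧
        ¬ AntitoneOn (fun t => gibbsEntropy (solutionDensity (-1) 1 (1 / 4) 1 t)) (Ici 0)) ∧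
      (¬ MonotoneOn (fun t => conditionalEntropy (solutionDensity (-1) 1 (1 / 4) 1 t)
          (stationaryDensity (-1) 1 (1 / 4))) (Ici 0) ∧
        ¬ AntitoneOn (fun t => conditionalEntropy (solutionDensity (-1) 1 (1 / 4) 1 t)
          (stationaryDensity (-1) 1 (1 / 4))) (Ici 0))) := by
  refine ⟨fun b τ σ σbar hτ hσ hσbar => ⟨isFundamentalSolution_fundamentalSolution hτ, ?_, ?_, ?_⟩,
    integrableOn_fundamentalSolution_neg_one_sq, not_monotone_neg_one⟩
  · intro Ω _ P _ W w x z hW hw hind hx hz t ht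
    have hlaw := hasLaw_delaySolution hτ hσ hW hw hind hx hz ht
    refine ⟨hasLaw_noiseless hτ hW hz ht, hasLaw_sub_noiseless hτ hw hx hz ht,
      indepFun_noiseless_sub hτ hW hw hind hx hz ht, hlaw, ?_⟩
    -- Positivity of the variance excludes the Dirac case, so the law has a density.
    rw [hlaw.map_eq, gaussianReal_of_var_ne_zero _
      (by simpa using totalVariance_pos hτ hσ hσbar ht)]
    rfl
  · intro t ht
    have hv := totalVariance_pos (b := b) hτ hσ hσbar ht
    exact ⟨hv, totalVariance_eq hτ hσ ht, integrable_gaussianPDFReal_mul_log hv,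
      gibbsEntropy_gaussianPDFReal hv⟩
  · intro hint
    have hs := stationaryVariance_pos hτ hσ hint
    exact ⟨hs, tendsto_gaussianPDFReal_zero hs (tendsto_totalVariance hint), fun t ht =>
      have hv := totalVariance_pos (b := b) hτ hσ hσbar ht
      ⟨integrable_gaussianPDFReal_mul_log_div hv hs, conditionalEntropy_gaussianPDFReal hv hs⟩⟩
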